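/- Let $K\ge 2$ and let $\Phi=(\varphi_1,\dots,\varphi_K)$ be a unit norm tight frame in $\mathbb R^d$ with frame constant $A=K/d$, i.e. $\|\varphi_i\|_2=1$ for all $i$ and $\sum_{i=1}^K|\langle\varphi_i,v\rangle|^2=A\|v\|_2^2$ for all $v\in\mathbb R^d$, and with coherence $\mu=\max_{i\neq j}|\langle\varphi_i,\varphi_j\rangle|$. Let $x$ be distributed according to a probability measure $\nu$ on the unit sphere $S^{K-1}\subset\mathbb R^K$ that is symmetric, i.e. invariant under all sign changes $x\mapsto(s_1x_1,\dots,s_Kx_K)$, $s_i=\pm1$, and all permutations of the coordinates, and put $\bar c_1^2:=\mathbb E_x\|x\|_\infty^2$. Let the signals be $$y=\Phi x+r,\qquad \Phi x=\sum_{i=1}^K x_i\varphi_i,$$ where $r$ is bounded white noise independent of $x$: there are constants $\rho,\sigma$ with $\|r\|_2\le\rho$ almost surely, $\mathbb E(r)=0$ and $\mathbb E(rr^\star)=\sigma^2 I$. For $x\in S^{K-1}$ let $c_1(x)\ge c_2(x)\ge\dots\ge c_K(x)\ge0$ be the non-increasing rearrangement of the absolute values of the entries of $x$. Assume that there is $\beta<1/2$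 such that, $\nu$-almost surely, $c_1(x)>c_2(x)$ and $$\frac{c_2(x)+\mu\|c(x)\|_1+\rho}{c_1(x)-c_2(x)}\le\beta .$$ For $\Psi=(\psi_1,\dots,\psi_K)$ write $\|\Psi^\star y\|_\infty=\max_i|\langle\psi_i,y\rangle|$, and let $\mathcal D$ be the set of all $\Psi$ with $\|\psi_i\|_2=1$ for all $i$. Then the expectations $\mathbb E_y\|\Psi^\star y\|_\infty^2$ are finite, and $\Phi$ is a local maximum of $\Psi\mapsto\mathbb E_y\|\Psi^\star y\|_\infty^2$ on $\mathcal D$. Moreover, whenever $$\varepsilon<\frac15\qquad\text{and}\qquad \varepsilon\le\frac{(1-2\beta)^2}{2A\log\!\Big(2AK\big/\big(\bar c_1^2-\tfrac{1-\bar c_1^2}{K-1}\big)\Big)},$$ every $\Psi\in\mathcal D$ with $0<\max_i\|\psi_i-\varphi_i\|_2\le\varepsilon$ satisfies $$\mathbb E_y\|\Psi^\star y\|_\infty^2<\mathbb E_y\|\Phi^\star y\|_\infty^2 .$$ -/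

import Mathlib

open MeasureTheory ProbabilityTheory

noncomputable section

namespace DictLearn

/-- A collection of `K` atoms (the columns of a `d × K` matrix) in Euclidean `ℝ^d`. -/
abbrev Dict (d K : ℕ) : Type := Fin K → EuclideanSpace ℝ (Fin d)

/-- The unit sphere of Euclidean `ℝ^K`. -/
abbrev Sph (K : ℕ) : Type := Metric.sphere (0 : EuclideanSpace ℝ (Fin K)) 1

/-- The admissible dictionaries: all atoms have Euclidean norm one. -/
def admissible (d K : ℕ) : Set (Dict d K) := {Ψ | ∀ i, ‖Ψ i‖ = 1}

/-- `Φ x = ∑ i, x(i) φ_i`. -/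
def synth {d K : ℕ} (Φ : Dict d K) (x : EuclideanSpace ℝ (Fin K)) : EuclideanSpace ℝ (Fin d) :=
  ∑ i, x i • Φ i

/-- `Ψ* y = (⟨ψ_i, y⟩)_i`; the norm on `Fin K → ℝ` is the maximum norm. -/
def analysis {d K : ℕ} (Ψ : Dict d K) (y : EuclideanSpace ℝ (Fin d)) : Fin K → ℝ :=
  fun i => inner ℝ (Ψ i) y

/-- `Φ` is a tight frame with frame constant `A`. -/
def IsTightFrame {d K : ℕ} (Φ : Dict d K) (A : ℝ) : Prop :=
  0 < A ∧ ∀ v : EuclideanSpace ℝ (Fin d), ∑ i, |inner ℝ (Φ i) v| ^ 2 = A * ‖v‖ ^ 2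

/-- The coherence `max_{i ≠ j} |⟨φ_i, φ_j⟩|`. -/
def coherence {d K : ℕ} (Φ : Dict d K) : ℝ :=
  ⨆ p : {p : Fin K × Fin K // p.1 ≠ p.2}, |inner ℝ (Φ p.1.1) (Φ p.1.2)|

/-- `max_i ‖ψ_i - φ_i‖_2`. -/
def dictDist {d K : ℕ} (Ψ Φ : Dict d K) : ℝ := ⨆ i, ‖Ψ i - Φ i‖

/-- The non-increasing rearrangement `c(x)` of the absolute values of the entries of `x`
(zero-based: `c_1(x)` is `rearr x 0`). -/
def rearr {K : ℕ} (x : EuclideanSpace ℝ (Fin K)) : Fin K → ℝ :=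
  fun k => |x (Tuple.sort (fun j => -|x j|) k)|

theorem rearr_antitone {K : ℕ} (x : EuclideanSpace ℝ (Fin K)) : Antitone (rearr x) := by
  intro a b hab
  have h := Tuple.monotone_sort (fun j => -|x j|) hab
  simpa [rearr] using h

/-- `x ↦ (σ_1 x_1, …, σ_K x_K)` on the sphere. -/
def signAct {K : ℕ} (σ : Fin K → ℤˣ) (x : Sph K) : Sph K :=
  ⟨WithLp.toLp 2 (fun i => ((σ i : ℤ) : ℝ) * (x : EuclideanSpace ℝ (Fin K)) i), by
    have hx : ‖(x : EuclideanSpace ℝ (Fin K))‖ = 1 := norm_eq_of_mem_sphere x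
    have hs : ∀ i, |((σ i : ℤ) : ℝ)| = 1 := fun i => by
      rcases Int.units_eq_one_or (σ i) with h | h <;> simp [h]
    rw [mem_sphere_zero_iff_norm]
    refine Eq.trans ?_ hx
    rw [EuclideanSpace.norm_eq, EuclideanSpace.norm_eq]
    simp only [Real.norm_eq_abs, abs_mul, hs, one_mul]⟩

/-- `x ↦ (x_{p(1)}, …, x_{p(K)})` on the sphere. -/
def permAct {K : ℕ} (p : Equiv.Perm (Fin K)) (x : Sph K) : Sph K :=
  ⟨WithLp.toLp 2 (fun i => (x : EuclideanSpace ℝ (Fin K)) (p i)), by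
    have hx : ‖(x : EuclideanSpace ℝ (Fin K))‖ = 1 := norm_eq_of_mem_sphere x
    rw [mem_sphere_zero_iff_norm]
    refine Eq.trans ?_ hx
    rw [EuclideanSpace.norm_eq, EuclideanSpace.norm_eq]
    congr 1
    exact Equiv.sum_comp p (fun i => ‖(x : EuclideanSpace ℝ (Fin K)) i‖ ^ 2)⟩

/-- A measure on the sphere is symmetric if it is invariant under all sign changes and all
permutations of the coordinates. -/
def IsSymmetric {K : ℕ} (ν : Measure (Sph K)) : Prop :=
  ∀ X : Set (Sph K), MeasurableSet X →
    (∀ σ : Fin K → ℤˣ, ν (signAct σ '' X) = ν X) ∧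
    (∀ p : Equiv.Perm (Fin K), ν (permAct p '' X) = ν X)

/-- Bounded white noise: `‖r‖_2 ≤ ρ` almost surely, `E r = 0`, `E (r r*) = s² I`. -/
structure IsBoundedWhiteNoise {Ω : Type*} [MeasurableSpace Ω] (P : Measure Ω) {d : ℕ}
    (r : Ω → EuclideanSpace ℝ (Fin d)) (ρ s : ℝ) : Prop where
  aemeasurable : AEMeasurable r P
  bounded : ∀ᵐ ω ∂P, ‖r ω‖ ≤ ρ
  mean : ∫ ω, r ω ∂P = 0
  covariance : (Matrix.of fun i j => ∫ ω, r ω i * r ω j ∂P) =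
    s ^ 2 • (1 : Matrix (Fin d) (Fin d) ℝ)

/-- The objective `Ψ ↦ E ‖Ψ* y‖_∞²`. -/
def objective {Ω : Type*} [MeasurableSpace Ω] (P : Measure Ω) {d K : ℕ}
    (y : Ω → EuclideanSpace ℝ (Fin d)) (Ψ : Dict d K) : ℝ :=
  ∫ ω, ‖analysis Ψ (y ω)‖ ^ 2 ∂P

end DictLearn

end

namespace DictLearn

/-! Fix the coefficients `z` and the noise `w`, and average over the signs of the entries of `z`. If
`i` is the index of the largest modulus, the average of `⟨ψ_i, y⟩²` is `∑ k, z k ^ 2 * ⟨ψ_i, φ_k⟩² +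
⟨ψ_i, w⟩²`, because the cross terms cancel. This never exceeds the averaged response, since the
maximum is at least its `i`-th entry (`le_sum_signs_analysis`). For `Ψ` near `Φ` it is also almost
an upper bound (`sum_signs_analysis_le`): the decay condition makes `i` the maximiser unless some
Rademacher sum `⟨ψ_j - φ_j, Φ z⟩`, taken without its `i`-th term, is large. By Hoeffding that event
has probability exponentially small in `1 / e ^ 2`, where `e` is the distance from `Ψ` to `Φ`.

It remains to integrate the main term (`integral_dominantResponse_sub`). White noise is isotropic
and contributes equally to `Φ` and `Ψ`. By symmetry of `ν`, the second moment of entry `k` when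
entry `i` dominates depends only on whether `k = i`, and tightness fixes `∑ k, ⟨ψ_i, φ_k⟩² = A`. So
only the diagonal terms `⟨ψ_i, φ_i⟩ = 1 - ‖ψ_i - φ_i‖² / 2` distinguish the two dictionaries. With
`g = m - (1 - m) / (K - 1)` and `m` the mean squared maximum norm, the loss is at least `g / K * (e
^ 2 - e ^ 4 / 4)`. The condition on `ε` makes this loss beat the exponentially small gain
(`excess_lt`). -/

/-! ### Rademacher sums: second moments and tail bounds -/

/-- Flipping the `k`-th sign permutes the sign patterns and negates the sum. -/
theorem sum_signs_apply {K : ℕ} (k : Fin K) :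
    ∑ σ : Fin K → ℤˣ, ((σ k : ℤ) : ℝ) = 0 := by
  have h := Equiv.sum_comp (Equiv.mulLeft (Pi.mulSingle k (-1) : Fin K → ℤˣ))
    (fun σ : Fin K → ℤˣ => ((σ k : ℤ) : ℝ))
  simp only [Equiv.coe_mulLeft, Pi.mul_apply, Pi.mulSingle_eq_same] at h
  push_cast at h
  simp only [neg_mul, one_mul, Finset.sum_neg_distrib] at h
  linarith

theorem sum_signs_mul {K : ℕ} {k l : Fin K} (hkl : k ≠ l) :
    ∑ σ : Fin K → ℤˣ, ((σ k : ℤ) : ℝ) * ((σ l : ℤ) : ℝ) = 0 := by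
  have h := Equiv.sum_comp (Equiv.mulLeft (Pi.mulSingle k (-1) : Fin K → ℤˣ))
    (fun σ : Fin K → ℤˣ => ((σ k : ℤ) : ℝ) * ((σ l : ℤ) : ℝ))
  simp only [Equiv.coe_mulLeft, Pi.mul_apply, Pi.mulSingle_eq_same,
    Pi.mulSingle_eq_of_ne hkl.symm] at h
  push_cast at h
  simp only [neg_mul, one_mul, Finset.sum_neg_distrib] at h
  linarith

theorem unit_cast_sq (a : ℤˣ) : ((a : ℤ) : ℝ) ^ 2 = 1 := by
  rcases Int.units_eq_one_or a with h | h <;> simp [h]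

theorem abs_unit_cast (a : ℤˣ) : |((a : ℤ) : ℝ)| = 1 := by
  rcases Int.units_eq_one_or a with h | h <;> simp [h]

theorem card_signs (K : ℕ) : (Fintype.card (Fin K → ℤˣ) : ℝ) = 2 ^ K := by
  simp

/-- The second moment of a Rademacher sum with an offset. -/
theorem sum_signs_sq {K : ℕ} (a : Fin K → ℝ) (b : ℝ) :
    ∑ σ : Fin K → ℤˣ, (∑ k, ((σ k : ℤ) : ℝ) * a k + b) ^ 2 = 2 ^ K * (∑ k, a k ^ 2 + b ^ 2) := by
  have h1 : ∀ σ : Fin K → ℤˣ, (∑ k, ((σ k : ℤ) : ℝ) * a k + b) ^ 2 =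
      ∑ k, ∑ l, (((σ k : ℤ) : ℝ) * ((σ l : ℤ) : ℝ)) * (a k * a l)
        + ∑ k, ((σ k : ℤ) : ℝ) * (2 * a k * b) + b ^ 2 := by
    intro σ
    have : ∑ k, ((σ k : ℤ) : ℝ) * (2 * a k * b) = 2 * (∑ k, ((σ k : ℤ) : ℝ) * a k) * b := by
      rw [Finset.mul_sum, Finset.sum_mul]; exact Finset.sum_congr rfl fun _ _ => by ring
    rw [this, add_sq, sq (∑ k, _), Finset.sum_mul_sum]
    congr 2
    exact Finset.sum_congr rfl fun _ _ => Finset.sum_congr rfl fun _ _ => by ring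
  simp only [h1, Finset.sum_add_distrib]
  rw [Finset.sum_comm, Finset.sum_comm (f := fun (σ : Fin K → ℤˣ) k => ((σ k : ℤ) : ℝ) * (2 * a k * b))]
  simp only [← Finset.sum_mul, sum_signs_apply, zero_mul, Finset.sum_const_zero, add_zero]
  have h2 : ∀ k, ∑ σ : Fin K → ℤˣ, ∑ l, (((σ k : ℤ) : ℝ) * ((σ l : ℤ) : ℝ)) * (a k * a l)
      = 2 ^ K * a k ^ 2 := by
    intro k
    rw [Finset.sum_comm]
    simp only [← Finset.sum_mul]
    rw [Finset.sum_eq_single k]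
    · simp only [← sq, unit_cast_sq, Finset.sum_const, Finset.card_univ, nsmul_eq_mul, card_signs,
        mul_one]
    · intro l _ hl
      rw [sum_signs_mul hl.symm, zero_mul]
    · simp
  simp only [h2, Finset.sum_const, Finset.card_univ, nsmul_eq_mul, card_signs]
  rw [mul_add, Finset.mul_sum]

/-- The exponential moment factors over coordinates, and each factor is controlled by `cosh t ≤ exp
(t ^ 2 / 2)`. -/
theorem sum_signs_exp_le {K : ℕ} (a : Fin K → ℝ) :
    ∑ σ : Fin K → ℤˣ, Real.exp (∑ k, ((σ k : ℤ) : ℝ) * a k)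
      ≤ 2 ^ K * Real.exp ((∑ k, a k ^ 2) / 2) := by
  have h : ∏ k, ∑ s : ℤˣ, Real.exp (((s : ℤ) : ℝ) * a k)
      = ∑ σ : Fin K → ℤˣ, Real.exp (∑ k, ((σ k : ℤ) : ℝ) * a k) := by
    rw [Fintype.prod_sum]
    exact Finset.sum_congr rfl fun σ _ => (Real.exp_sum _ _).symm
  rw [← h, Finset.sum_div, Real.exp_sum]
  have h2 : (2 : ℝ) ^ K = ∏ _k : Fin K, (2 : ℝ) := by simp
  rw [h2, ← Finset.prod_mul_distrib]
  refine Finset.prod_le_prod (fun _ _ => Finset.sum_nonneg fun _ _ => (Real.exp_pos _).le) ?_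
  intro k _
  have h3 : ∑ s : ℤˣ, Real.exp (((s : ℤ) : ℝ) * a k) = 2 * Real.cosh (a k) := by
    rw [Real.cosh_eq]
    have : (Finset.univ : Finset ℤˣ) = {1, -1} := rfl
    rw [this, Finset.sum_pair (by decide)]
    simp; ring
  rw [h3]
  exact mul_le_mul_of_nonneg_left (Real.cosh_le_exp_half_sq _) (by norm_num)

-- Chernoff's bound with the optimal exponential parameter `t / W`.
open Classical in
theorem card_signs_lt_sum_le {K : ℕ} (a : Fin K → ℝ) {t W : ℝ} (ht : 0 ≤ t) (hW : 0 < W)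
    (ha : ∑ k, a k ^ 2 ≤ W) :
    (∑ σ : Fin K → ℤˣ, if t < ∑ k, ((σ k : ℤ) : ℝ) * a k then (1 : ℝ) else 0)
      ≤ 2 ^ K * Real.exp (-t ^ 2 / (2 * W)) := by
  have h1 := sum_signs_exp_le (fun k => t / W * a k)
  have h2 : (∑ k, (t / W * a k) ^ 2) / 2 ≤ t ^ 2 / (2 * W) := by
    simp only [mul_pow, ← Finset.mul_sum]
    calc (t / W) ^ 2 * (∑ k, a k ^ 2) / 2 ≤ (t / W) ^ 2 * W / 2 := by gcongr
      _ = t ^ 2 / (2 * W) := by field_simp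
  have h3 : ∀ σ : Fin K → ℤˣ, (if t < ∑ k, ((σ k : ℤ) : ℝ) * a k then (1 : ℝ) else 0)
      ≤ Real.exp (-(t ^ 2 / W)) * Real.exp (∑ k, ((σ k : ℤ) : ℝ) * (t / W * a k)) := by
    intro σ
    split_ifs with h
    · rw [← Real.exp_add]
      refine Real.one_le_exp ?_
      have h5 : ∑ k, ((σ k : ℤ) : ℝ) * (t / W * a k) = t / W * ∑ k, ((σ k : ℤ) : ℝ) * a k := by
        rw [Finset.mul_sum]; exact Finset.sum_congr rfl fun _ _ => by ring
      have h6 : t ^ 2 / W = t / W * t := by ring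
      rw [h5, h6]
      have := mul_le_mul_of_nonneg_left h.le (div_nonneg ht hW.le)
      linarith
    · positivity
  calc _ ≤ ∑ σ : Fin K → ℤˣ, Real.exp (-(t ^ 2 / W)) *
        Real.exp (∑ k, ((σ k : ℤ) : ℝ) * (t / W * a k)) := Finset.sum_le_sum fun σ _ => h3 σ
    _ ≤ Real.exp (-(t ^ 2 / W)) * (2 ^ K * Real.exp (t ^ 2 / (2 * W))) := by
        rw [← Finset.mul_sum]
        gcongr
        exact h1.trans (by gcongr)
    _ = 2 ^ K * Real.exp (-t ^ 2 / (2 * W)) := by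
        rw [mul_left_comm, ← Real.exp_add]
        congr 2
        field_simp
        ring

open Classical in
/-- Hoeffding's inequality for Rademacher sums, in counting form. -/
theorem hoeffding_signs {K : ℕ} (a : Fin K → ℝ) {c u W : ℝ} (hc : 0 ≤ c) (hu : 0 ≤ u) (hW : 0 < W)
    (ha : ∑ k, a k ^ 2 ≤ c ^ 2 * W) :
    (∑ σ : Fin K → ℤˣ, if c * u < |∑ k, ((σ k : ℤ) : ℝ) * a k| then (1 : ℝ) else 0)
      ≤ 2 * 2 ^ K * Real.exp (-u ^ 2 / (2 * W)) := by
  -- For `c = 0` all `a k` vanish and the strict inequality defining the event fails, so the count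
  -- is zero.
  rcases hc.eq_or_lt with rfl | hc
  · have ha0 : ∀ k, a k = 0 := by
      have h0 : ∑ k, a k ^ 2 = 0 :=
        le_antisymm (by simpa using ha) (Finset.sum_nonneg fun _ _ => sq_nonneg _)
      intro k
      have := (Finset.sum_eq_zero_iff_of_nonneg (fun _ _ => sq_nonneg _)).1 h0 k (Finset.mem_univ k)
      simpa using this
    simp only [ha0]
    simp
    positivity
  · have hW' : 0 < c ^ 2 * W := by positivity
    have h1 := card_signs_lt_sum_le a (mul_nonneg hc.le hu) hW' ha
    have h2 := card_signs_lt_sum_le (fun k => -a k) (mul_nonneg hc.le hu) hW' (by simpa using ha)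
    have h3 : -(c * u) ^ 2 / (2 * (c ^ 2 * W)) = -u ^ 2 / (2 * W) := by
      field_simp
    rw [h3] at h1 h2
    have h4 : (∑ σ : Fin K → ℤˣ, if c * u < |∑ k, ((σ k : ℤ) : ℝ) * a k| then (1 : ℝ) else 0)
      ≤ (∑ σ : Fin K → ℤˣ, if c * u < ∑ k, ((σ k : ℤ) : ℝ) * a k then (1 : ℝ) else 0)
       + (∑ σ : Fin K → ℤˣ, if c * u < ∑ k, ((σ k : ℤ) : ℝ) * -a k then (1 : ℝ) else 0) := by
      rw [← Finset.sum_add_distrib]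
      refine Finset.sum_le_sum fun σ _ => ?_
      have hneg : ∑ k, ((σ k : ℤ) : ℝ) * -a k = -∑ k, ((σ k : ℤ) : ℝ) * a k := by simp
      rw [hneg]
      by_cases h5 : c * u < |∑ k, ((σ k : ℤ) : ℝ) * a k|
      · rw [if_pos h5]
        rcases lt_abs.1 h5 with h6 | h6
        · rw [if_pos h6]
          split_ifs <;> norm_num
        · rw [if_pos h6]
          split_ifs <;> norm_num
      · rw [if_neg h5]
        split_ifs <;> norm_num
    linarith

/-! ### A single sample: the dominant index maximises the response -/

/-- The decay condition at a coefficient vector `z` with dominant index `i`; `c` is the second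
largest modulus. -/
structure DecayAt {K : ℕ} (μ ρ β : ℝ) (z : EuclideanSpace ℝ (Fin K)) (i : Fin K) (c : ℝ) :
    Prop where
  nonneg : 0 ≤ c
  lt : c < |z i|
  le : ∀ j, j ≠ i → |z j| ≤ c
  decay : c + μ * ∑ k, |z k| + ρ ≤ β * (|z i| - c)

/-- Sign changes of the entries of a vector. -/
def signVec {K : ℕ} (σ : Fin K → ℤˣ) (z : EuclideanSpace ℝ (Fin K)) : EuclideanSpace ℝ (Fin K) :=
  WithLp.toLp 2 (fun i => ((σ i : ℤ) : ℝ) * z i)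

theorem signVec_apply {K : ℕ} (σ : Fin K → ℤˣ) (z : EuclideanSpace ℝ (Fin K)) (i : Fin K) :
    signVec σ z i = ((σ i : ℤ) : ℝ) * z i := rfl

theorem abs_signVec {K : ℕ} (σ : Fin K → ℤˣ) (z : EuclideanSpace ℝ (Fin K)) (i : Fin K) :
    |signVec σ z i| = |z i| := by
  rw [signVec_apply, abs_mul, abs_unit_cast, one_mul]

theorem norm_signVec {K : ℕ} (σ : Fin K → ℤˣ) (z : EuclideanSpace ℝ (Fin K)) :
    ‖signVec σ z‖ = ‖z‖ := by
  rw [EuclideanSpace.norm_eq, EuclideanSpace.norm_eq]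
  simp only [Real.norm_eq_abs, abs_signVec]

theorem DecayAt.signVec {K : ℕ} {μ ρ β : ℝ} {z : EuclideanSpace ℝ (Fin K)} {i : Fin K} {c : ℝ}
    (h : DecayAt μ ρ β z i c) (σ : Fin K → ℤˣ) : DecayAt μ ρ β (signVec σ z) i c where
  nonneg := h.nonneg
  lt := by simpa only [abs_signVec] using h.lt
  le := by simpa only [abs_signVec] using h.le
  decay := by simpa only [abs_signVec] using h.decay

theorem inner_synth {d K : ℕ} (Φ : Dict d K) (x : EuclideanSpace ℝ (Fin K))
    (v : EuclideanSpace ℝ (Fin d)) : inner ℝ v (synth Φ x) = ∑ k, x k * inner ℝ v (Φ k) := by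
  simp [synth, inner_sum, inner_smul_right]

/-- Cauchy–Schwarz on `‖Φ x‖² = ∑ k, x k * ⟨Φ x, φ_k⟩`; tightness evaluates the second factor as `A
* ‖Φ x‖²`. -/
theorem norm_synth_sq_le {d K : ℕ} {Φ : Dict d K} {A : ℝ} (h : IsTightFrame Φ A)
    (x : EuclideanSpace ℝ (Fin K)) : ‖synth Φ x‖ ^ 2 ≤ A * ‖x‖ ^ 2 := by
  have h1 : ‖synth Φ x‖ ^ 2 = ∑ k, x k * inner ℝ (synth Φ x) (Φ k) := by
    rw [← inner_synth, real_inner_self_eq_norm_sq]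
  have h2 := Finset.sum_mul_sq_le_sq_mul_sq Finset.univ (fun k => x k)
    (fun k => inner ℝ (synth Φ x) (Φ k))
  have h3 : ∑ k, inner ℝ (synth Φ x) (Φ k) ^ 2 = A * ‖synth Φ x‖ ^ 2 := by
    rw [← h.2]
    exact Finset.sum_congr rfl fun k _ => by rw [sq_abs, real_inner_comm]
  have h4 : ∑ k, x k ^ 2 = ‖x‖ ^ 2 := by simp [EuclideanSpace.norm_sq_eq]
  rw [← h1, h3, h4] at h2
  rcases (sq_nonneg ‖synth Φ x‖).eq_or_lt with h0 | h0
  · rw [← h0]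
    have := h.1
    positivity
  · nlinarith

theorem abs_inner_synth_lower {d K : ℕ} {Φ : Dict d K} {μ : ℝ} (hμ0 : 0 ≤ μ)
    (hΦ : Φ ∈ admissible d K) (hμ : ∀ j k, j ≠ k → |inner ℝ (Φ j) (Φ k)| ≤ μ)
    (z : EuclideanSpace ℝ (Fin K)) (j : Fin K) :
    |inner ℝ (Φ j) (synth Φ z) - z j| ≤ μ * ∑ k, |z k| := by
  have h1 : inner ℝ (Φ j) (synth Φ z) - z j
      = ∑ k ∈ Finset.univ.erase j, z k * inner ℝ (Φ j) (Φ k) := by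
    rw [inner_synth, ← Finset.add_sum_erase _ _ (Finset.mem_univ j), real_inner_self_eq_norm_sq,
      hΦ j]
    ring
  rw [h1, Finset.mul_sum]
  calc |∑ k ∈ Finset.univ.erase j, z k * inner ℝ (Φ j) (Φ k)|
      ≤ ∑ k ∈ Finset.univ.erase j, |z k * inner ℝ (Φ j) (Φ k)| := Finset.abs_sum_le_sum_abs _ _
    _ ≤ ∑ k ∈ Finset.univ.erase j, μ * |z k| := by
        refine Finset.sum_le_sum fun k hk => ?_
        rw [abs_mul, mul_comm]
        exact mul_le_mul_of_nonneg_right (hμ j k (Finset.ne_of_mem_erase hk).symm) (abs_nonneg _)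
    _ ≤ ∑ k, μ * |z k| := Finset.sum_le_sum_of_subset_of_nonneg (Finset.erase_subset _ _)
        fun k _ _ => mul_nonneg hμ0 (abs_nonneg _)

/-- The part of `⟨v, Φ z⟩` that does not come from the dominant index `i`. -/
noncomputable def offCoeff {d K : ℕ} (Φ : Dict d K) (z : EuclideanSpace ℝ (Fin K)) (i : Fin K)
    (v : EuclideanSpace ℝ (Fin d)) (k : Fin K) : ℝ :=
  if k = i then 0 else z k * inner ℝ v (Φ k)

/-- This is the variance fed to Hoeffding. Only non-dominant entries occur, each at most `c` in
modulus, and tightness sums the squared inner products with `v`. -/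
theorem sum_offCoeff_sq_le {d K : ℕ} {Φ : Dict d K} {A : ℝ} (h : IsTightFrame Φ A)
    {μ ρ β : ℝ} {z : EuclideanSpace ℝ (Fin K)} {i : Fin K} {c : ℝ}
    (hz : DecayAt μ ρ β z i c) {v : EuclideanSpace ℝ (Fin d)} {e : ℝ} (hv : ‖v‖ ≤ e) :
    ∑ k, offCoeff Φ z i v k ^ 2 ≤ c ^ 2 * (A * e ^ 2) := by
  have h0 := h.1
  calc ∑ k, offCoeff Φ z i v k ^ 2 ≤ ∑ k, c ^ 2 * |inner ℝ (Φ k) v| ^ 2 := by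
        refine Finset.sum_le_sum fun k _ => ?_
        unfold offCoeff
        split_ifs with hk
        · rw [zero_pow two_ne_zero]
          positivity
        · rw [mul_pow, ← sq_abs (z k), sq_abs (inner ℝ (Φ k) v), real_inner_comm]
          gcongr
          exact hz.le k hk
    _ = c ^ 2 * (A * ‖v‖ ^ 2) := by rw [← Finset.mul_sum, h.2]
    _ ≤ c ^ 2 * (A * e ^ 2) := by gcongr

theorem inner_synth_eq_offCoeff {d K : ℕ} (Φ : Dict d K) (z : EuclideanSpace ℝ (Fin K))
    (i : Fin K) (v : EuclideanSpace ℝ (Fin d)) :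
    inner ℝ v (synth Φ z) = z i * inner ℝ v (Φ i) + ∑ k, offCoeff Φ z i v k := by
  have h : ∀ k, z k * inner ℝ v (Φ k)
      = (if k = i then z k * inner ℝ v (Φ k) else 0) + offCoeff Φ z i v k := by
    intro k
    unfold offCoeff
    split_ifs <;> simp
  rw [inner_synth, Finset.sum_congr rfl fun k _ => h k, Finset.sum_add_distrib]
  simp

/-- A perturbation along the unit sphere is orthogonal to the atom up to second order, so the
dominant atom loses only a fraction `e ^ 2 / 2` of its coefficient. -/
theorem inner_sub_self_of_norm_one {E : Type*} [NormedAddCommGroup E] [InnerProductSpace ℝ E]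
    {a b : E} (ha : ‖a‖ = 1) (hb : ‖b‖ = 1) :
    inner ℝ (a - b) b = -(‖a - b‖ ^ 2 / 2) := by
  rw [norm_sub_sq_real, inner_sub_left, real_inner_self_eq_norm_sq, ha, hb]
  ring

/-- Outside the exceptional event, the dominant index of `z` maximises `|⟨ψ_j, Φ z + w⟩|`. -/
theorem DecayAt.abs_inner_le {d K : ℕ} {Φ Ψ : Dict d K} {μ ρ β e : ℝ} (hμ0 : 0 ≤ μ)
    (hΦ : Φ ∈ admissible d K) (hΨ : Ψ ∈ admissible d K)
    (hμ : ∀ j k, j ≠ k → |inner ℝ (Φ j) (Φ k)| ≤ μ)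
    (hd : ∀ j, ‖Ψ j - Φ j‖ ≤ e) (hβ0 : 0 ≤ β) (hβ : β < 1 / 2)
    (he0 : 0 ≤ e) (he : e < 1 / 5) (heβ : e ≤ (1 - 2 * β) ^ 2 / 2)
    {z : EuclideanSpace ℝ (Fin K)} {i : Fin K} {c : ℝ} (hz : DecayAt μ ρ β z i c)
    {w : EuclideanSpace ℝ (Fin d)} (hw : ‖w‖ ≤ ρ)
    (hgood : ∀ j, |∑ k, offCoeff Φ z i (Ψ j - Φ j) k| ≤ c * (1 - 2 * β)) (j : Fin K) :
    |inner ℝ (Ψ j) (synth Φ z + w)| ≤ |inner ℝ (Ψ i) (synth Φ z + w)| := by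
  rcases eq_or_ne j i with rfl | hji
  · exact le_rfl
  -- Write `ψ_l = φ_l + (ψ_l - φ_l)`. The `i`-th term of the perturbation is kept apart because its
  -- size is second order for `l = i` and first order otherwise.
  have key : ∀ l, |inner ℝ (Ψ l) (synth Φ z + w) - z l - z i * inner ℝ (Ψ l - Φ l) (Φ i)|
      ≤ μ * ∑ k, |z k| + c * (1 - 2 * β) + ρ := by
    intro l
    have h1 : inner ℝ (Ψ l) (synth Φ z + w) - z l - z i * inner ℝ (Ψ l - Φ l) (Φ i)
        = (inner ℝ (Φ l) (synth Φ z) - z l) + ∑ k, offCoeff Φ z i (Ψ l - Φ l) k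
          + inner ℝ (Ψ l) w := by
      have h2 := inner_synth_eq_offCoeff Φ z i (Ψ l - Φ l)
      have h3 : inner ℝ (Ψ l - Φ l) (synth Φ z)
        = inner ℝ (Ψ l) (synth Φ z) - inner ℝ (Φ l) (synth Φ z) := inner_sub_left _ _ _
      rw [inner_add_right]
      linarith
    rw [h1]
    have h4 : |inner ℝ (Ψ l) w| ≤ ρ := by
      have := abs_real_inner_le_norm (Ψ l) w
      rw [hΨ l, one_mul] at this
      exact this.trans hw
    exact (abs_add_three _ _ _).trans
      (add_le_add (add_le_add (abs_inner_synth_lower hμ0 hΦ hμ z l) (hgood l)) h4)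
  have hi : |z i * inner ℝ (Ψ i - Φ i) (Φ i)| ≤ |z i| * (e ^ 2 / 2) := by
    have h0 : 0 ≤ ‖Ψ i - Φ i‖ ^ 2 / 2 := by positivity
    rw [abs_mul, inner_sub_self_of_norm_one (hΨ i) (hΦ i), abs_neg, abs_of_nonneg h0]
    have := hd i
    gcongr
  have hj : |z i * inner ℝ (Ψ j - Φ j) (Φ i)| ≤ |z i| * e := by
    rw [abs_mul]
    have h1 := abs_real_inner_le_norm (Ψ j - Φ j) (Φ i)
    rw [hΦ i, mul_one] at h1
    exact mul_le_mul_of_nonneg_left (h1.trans (hd j)) (abs_nonneg _)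
  have h1 : |z i| ≤ |inner ℝ (Ψ i) (synth Φ z + w)| + |z i| * (e ^ 2 / 2)
      + (μ * ∑ k, |z k| + c * (1 - 2 * β) + ρ) := by
    have h2 := abs_add_three (inner ℝ (Ψ i) (synth Φ z + w))
      (-(z i * inner ℝ (Ψ i - Φ i) (Φ i)))
      (-(inner ℝ (Ψ i) (synth Φ z + w) - z i - z i * inner ℝ (Ψ i - Φ i) (Φ i)))
    rw [abs_neg, abs_neg] at h2
    have h3 : inner ℝ (Ψ i) (synth Φ z + w) + -(z i * inner ℝ (Ψ i - Φ i) (Φ i))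
      + -(inner ℝ (Ψ i) (synth Φ z + w) - z i - z i * inner ℝ (Ψ i - Φ i) (Φ i)) = z i := by ring
    rw [h3] at h2
    linarith [key i]
  have h2 : |inner ℝ (Ψ j) (synth Φ z + w)| ≤ c + |z i| * e
      + (μ * ∑ k, |z k| + c * (1 - 2 * β) + ρ) := by
    have h2 := abs_add_three (z j) (z i * inner ℝ (Ψ j - Φ j) (Φ i))
      (inner ℝ (Ψ j) (synth Φ z + w) - z j - z i * inner ℝ (Ψ j - Φ j) (Φ i))
    have h3 : z j + (z i * inner ℝ (Ψ j - Φ j) (Φ i))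
      + (inner ℝ (Ψ j) (synth Φ z + w) - z j - z i * inner ℝ (Ψ j - Φ j) (Φ i))
      = inner ℝ (Ψ j) (synth Φ z + w) := by ring
    rw [h3] at h2
    linarith [key j, hz.le j hji]
  have hdec := hz.decay
  have hlt := hz.lt
  have hc := hz.nonneg
  have hμS : 0 ≤ μ * ∑ k, |z k| := mul_nonneg hμ0 (Finset.sum_nonneg fun _ _ => abs_nonneg _)
  have hρ : 0 ≤ ρ := (norm_nonneg w).trans hw
  set δ := |z i| - c with hδ
  have hzi : |z i| = δ + c := by rw [hδ]; ring
  have hδ0 : 0 < δ := sub_pos.2 hlt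
  -- The decay condition gives `c ≤ β * δ ≤ δ / 2`.
  have hcδ : 2 * c ≤ δ := by nlinarith
  have hη : e + e ^ 2 / 2 ≤ 1 - 2 * β := by nlinarith
  have hη' : e + e ^ 2 / 2 ≤ 2 / 3 := by nlinarith
  -- With `η = e + e ^ 2 / 2`, the claim reduces to `(1 - 2 * β - η) * δ + 2 * c - c * η ≥ 2 * c *
  -- (1 - 2 * β)`. Replacing `δ` by `2 * c` leaves `c * (2 - 3 * η) ≥ 0`, whence the constant `2 /
  -- 3`.
  have h3 : (1 - 2 * β - (e + e ^ 2 / 2)) * (2 * c) ≤ (1 - 2 * β - (e + e ^ 2 / 2)) * δ :=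
    mul_le_mul_of_nonneg_left hcδ (by linarith)
  have h4 : c * (e + e ^ 2 / 2) ≤ c * (2 / 3) := mul_le_mul_of_nonneg_left hη' hc
  rw [hzi] at h1 h2
  linarith

/-! ### Bounds on the sign-averaged response -/

theorem norm_analysis_sq_le {d K : ℕ} {Ψ : Dict d K} (hΨ : Ψ ∈ admissible d K)
    (y : EuclideanSpace ℝ (Fin d)) : ‖analysis Ψ y‖ ^ 2 ≤ ‖y‖ ^ 2 := by
  gcongr
  refine (pi_norm_le_iff_of_nonneg (norm_nonneg _)).2 fun j => ?_
  have := abs_real_inner_le_norm (Ψ j) y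
  rwa [hΨ j, one_mul] at this

theorem inner_sq_le_norm_analysis_sq {d K : ℕ} (Ψ : Dict d K)
    (y : EuclideanSpace ℝ (Fin d)) (i : Fin K) :
    inner ℝ (Ψ i) y ^ 2 ≤ ‖analysis Ψ y‖ ^ 2 := by
  rw [← sq_abs]
  gcongr
  exact norm_le_pi_norm (analysis Ψ y) i

/-- The sign average of `⟨v, Φ (σ z) + w⟩²`. -/
theorem sum_signs_inner_sq {d K : ℕ} (Φ : Dict d K) (z : EuclideanSpace ℝ (Fin K))
    (v w : EuclideanSpace ℝ (Fin d)) :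
    ∑ σ : Fin K → ℤˣ, inner ℝ v (synth Φ (signVec σ z) + w) ^ 2
      = 2 ^ K * (∑ k, z k ^ 2 * inner ℝ v (Φ k) ^ 2 + inner ℝ v w ^ 2) := by
  have h := sum_signs_sq (fun k => z k * inner ℝ v (Φ k)) (inner ℝ v w)
  simp only [mul_pow] at h
  rw [← h]
  refine Finset.sum_congr rfl fun σ _ => ?_
  rw [inner_add_right, inner_synth]
  congr 2
  exact Finset.sum_congr rfl fun k _ => by rw [signVec_apply, mul_assoc]

/-- The bound for the contribution of the exceptional event. -/
noncomputable def excess (A β e : ℝ) (K : ℕ) : ℝ :=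
  9 / 4 * A * (K * (2 * Real.exp (-(1 - 2 * β) ^ 2 / (2 * (A * e ^ 2)))))

theorem sum_signs_analysis_le {d K : ℕ} {Φ Ψ : Dict d K} {A μ ρ β e : ℝ} (hμ0 : 0 ≤ μ)
    (hA : IsTightFrame Φ A) (hA1 : 1 ≤ A)
    (hΦ : Φ ∈ admissible d K) (hΨ : Ψ ∈ admissible d K)
    (hμ : ∀ j k, j ≠ k → |inner ℝ (Φ j) (Φ k)| ≤ μ)
    (hd : ∀ j, ‖Ψ j - Φ j‖ ≤ e) (hβ0 : 0 ≤ β) (hβ : β < 1 / 2)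
    (he0 : 0 < e) (he : e < 1 / 5) (heβ : e ≤ (1 - 2 * β) ^ 2 / 2)
    {z : EuclideanSpace ℝ (Fin K)} (hz1 : ‖z‖ = 1) {i : Fin K} {c : ℝ} (hz : DecayAt μ ρ β z i c)
    {w : EuclideanSpace ℝ (Fin d)} (hw : ‖w‖ ≤ ρ) :
    ∑ σ : Fin K → ℤˣ, ‖analysis Ψ (synth Φ (signVec σ z) + w)‖ ^ 2
      ≤ 2 ^ K * (∑ k, z k ^ 2 * inner ℝ (Ψ i) (Φ k) ^ 2 + inner ℝ (Ψ i) w ^ 2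
          + excess A β e K) := by
  classical
  set u := 1 - 2 * β with hu
  have hu0 : 0 ≤ u := by linarith
  have hρ0 : 0 ≤ ρ := (norm_nonneg w).trans hw
  have hzi : |z i| ≤ 1 := by
    rw [← hz1]; exact PiLp.norm_apply_le z i
  -- The decay condition bounds `ρ` by `β * (|z i| - c)`, and `|z i| ≤ 1`.
  have hρ : ρ ≤ 1 / 2 := by
    have h1 := hz.decay
    have h2 : 0 ≤ μ * ∑ k, |z k| := mul_nonneg hμ0 (Finset.sum_nonneg fun _ _ => abs_nonneg _)
    have := hz.nonneg
    have := hz.lt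
    nlinarith
  -- Morally `‖y‖ ≤ √A + 1 / 2 ≤ (3 / 2) * √A`; the bound `t ≤ (1 + t ^ 2) / 2` avoids the square
  -- root.
  have hy : ∀ σ, ‖synth Φ (signVec σ z) + w‖ ^ 2 ≤ 9 / 4 * A := by
    intro σ
    have h1 := norm_synth_sq_le hA (signVec σ z)
    rw [norm_signVec, hz1, one_pow, mul_one] at h1
    have h2 : ‖synth Φ (signVec σ z) + w‖ ≤ ‖synth Φ (signVec σ z)‖ + 1 / 2 :=
      (norm_add_le _ _).trans (by linarith)
    have h3 : ‖synth Φ (signVec σ z)‖ ≤ (1 + A) / 2 := by nlinarith [sq_nonneg (‖synth Φ (signVec σ z)‖ - 1)]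
    have h5 := norm_nonneg (synth Φ (signVec σ z) + w)
    calc _ ≤ (‖synth Φ (signVec σ z)‖ + 1 / 2) ^ 2 := by gcongr
      _ ≤ 9 / 4 * A := by nlinarith [sq_nonneg (‖synth Φ (signVec σ z)‖ - 1)]
  set B : Fin K → (Fin K → ℤˣ) → ℝ := fun j σ =>
    if c * u < |∑ k, ((σ k : ℤ) : ℝ) * offCoeff Φ z i (Ψ j - Φ j) k| then (1 : ℝ) else 0 with hB
  have hB0 : ∀ j σ, 0 ≤ B j σ := fun j σ => by simp only [hB]; split_ifs <;> norm_num
  -- Union bound: on a bad sign pattern at least one indicator is one, and it pays for the trivial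
  -- bound on the response.
  have hpt : ∀ σ, ‖analysis Ψ (synth Φ (signVec σ z) + w)‖ ^ 2
      ≤ inner ℝ (Ψ i) (synth Φ (signVec σ z) + w) ^ 2 + 9 / 4 * A * ∑ j, B j σ := by
    intro σ
    by_cases hg : ∀ j, |∑ k, ((σ k : ℤ) : ℝ) * offCoeff Φ z i (Ψ j - Φ j) k| ≤ c * u
    · have hoff : ∀ j k, offCoeff Φ (signVec σ z) i (Ψ j - Φ j) k
          = ((σ k : ℤ) : ℝ) * offCoeff Φ z i (Ψ j - Φ j) k := by
        intro j k
        simp only [offCoeff, signVec_apply]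
        split_ifs <;> ring
      have h1 : ‖analysis Ψ (synth Φ (signVec σ z) + w)‖
          ≤ |inner ℝ (Ψ i) (synth Φ (signVec σ z) + w)| := by
        refine (pi_norm_le_iff_of_nonneg (abs_nonneg _)).2 fun j => ?_
        exact (hz.signVec σ).abs_inner_le hμ0 hΦ hΨ hμ hd hβ0 hβ he0.le he heβ hw
          (fun j => by simpa only [hoff] using hg j) j
      have h2 : ‖analysis Ψ (synth Φ (signVec σ z) + w)‖ ^ 2
          ≤ inner ℝ (Ψ i) (synth Φ (signVec σ z) + w) ^ 2 := by
        rw [← sq_abs (inner ℝ (Ψ i) _)]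
        gcongr
      have h3 : 0 ≤ ∑ j, B j σ := Finset.sum_nonneg fun j _ => hB0 j σ
      nlinarith
    · push Not at hg
      obtain ⟨j, hj⟩ := hg
      have h1 : 1 ≤ ∑ j, B j σ := by
        have h2 : B j σ = 1 := if_pos hj
        rw [← h2]
        exact Finset.single_le_sum (f := fun j => B j σ) (fun j _ => hB0 j σ) (Finset.mem_univ j)
      have h2 := (norm_analysis_sq_le hΨ (synth Φ (signVec σ z) + w)).trans (hy σ)
      have h3 := sq_nonneg (inner ℝ (Ψ i) (synth Φ (signVec σ z) + w))
      nlinarith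
  -- The threshold and the standard deviation bound both scale with `c`, so the tail bound is
  -- uniform in `z`.
  have hBsum : ∀ j, ∑ σ, B j σ ≤ 2 * 2 ^ K * Real.exp (-u ^ 2 / (2 * (A * e ^ 2))) := fun j =>
    hoeffding_signs _ hz.nonneg hu0 (by have := hA.1; positivity)
      (sum_offCoeff_sq_le hA hz (hd j))
  calc _ ≤ ∑ σ : Fin K → ℤˣ, (inner ℝ (Ψ i) (synth Φ (signVec σ z) + w) ^ 2
        + 9 / 4 * A * ∑ j, B j σ) := Finset.sum_le_sum fun σ _ => hpt σ
    _ = 2 ^ K * (∑ k, z k ^ 2 * inner ℝ (Ψ i) (Φ k) ^ 2 + inner ℝ (Ψ i) w ^ 2)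
        + 9 / 4 * A * ∑ j, ∑ σ, B j σ := by
      rw [Finset.sum_add_distrib, sum_signs_inner_sq, ← Finset.mul_sum, Finset.sum_comm]
    _ ≤ 2 ^ K * (∑ k, z k ^ 2 * inner ℝ (Ψ i) (Φ k) ^ 2 + inner ℝ (Ψ i) w ^ 2)
        + 9 / 4 * A * ∑ j : Fin K, 2 * 2 ^ K * Real.exp (-u ^ 2 / (2 * (A * e ^ 2))) := by
      have := hA.1
      gcongr with j
      exact hBsum j
    _ = _ := by
      simp only [excess, ← hu, Finset.sum_const, Finset.card_univ, Fintype.card_fin, nsmul_eq_mul]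
      ring

theorem le_sum_signs_analysis {d K : ℕ} (Φ Ψ : Dict d K) (z : EuclideanSpace ℝ (Fin K))
    (i : Fin K) (w : EuclideanSpace ℝ (Fin d)) :
    2 ^ K * (∑ k, z k ^ 2 * inner ℝ (Ψ i) (Φ k) ^ 2 + inner ℝ (Ψ i) w ^ 2)
      ≤ ∑ σ : Fin K → ℤˣ, ‖analysis Ψ (synth Φ (signVec σ z) + w)‖ ^ 2 := by
  rw [← sum_signs_inner_sq]
  exact Finset.sum_le_sum fun σ _ => inner_sq_le_norm_analysis_sq _ _ _

/-! ### Symmetries of the sphere and moments on the dominance events -/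

theorem coe_signAct {K : ℕ} (σ : Fin K → ℤˣ) (z : Sph K) :
    (signAct σ z : EuclideanSpace ℝ (Fin K)) = signVec σ z := rfl

theorem permAct_apply {K : ℕ} (p : Equiv.Perm (Fin K)) (z : Sph K) (i : Fin K) :
    (permAct p z : EuclideanSpace ℝ (Fin K)) i = (z : EuclideanSpace ℝ (Fin K)) (p i) := rfl

theorem continuous_coord {K : ℕ} (i : Fin K) :
    Continuous fun z : Sph K => (z : EuclideanSpace ℝ (Fin K)) i := by fun_prop

theorem continuous_signAct {K : ℕ} (σ : Fin K → ℤˣ) : Continuous (signAct σ) := by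
  refine Continuous.subtype_mk ?_ _
  fun_prop

theorem continuous_permAct {K : ℕ} (p : Equiv.Perm (Fin K)) : Continuous (permAct p) := by
  refine Continuous.subtype_mk ?_ _
  fun_prop

theorem signAct_signAct {K : ℕ} (σ : Fin K → ℤˣ) (z : Sph K) : signAct σ (signAct σ z) = z := by
  refine Subtype.ext ?_
  ext i
  rw [coe_signAct, signVec_apply, coe_signAct, signVec_apply, ← mul_assoc, ← sq, unit_cast_sq,
    one_mul]

theorem permAct_swap_permAct_swap {K : ℕ} (a b : Fin K) (z : Sph K) :
    permAct (Equiv.swap a b) (permAct (Equiv.swap a b) z) = z := by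
  refine Subtype.ext ?_
  ext i
  simp [permAct_apply]

theorem IsSymmetric.measurePreserving_signAct {K : ℕ} {ν : Measure (Sph K)} (hν : IsSymmetric ν)
    (σ : Fin K → ℤˣ) : MeasurePreserving (signAct σ) ν ν := by
  refine ⟨(continuous_signAct σ).measurable, Measure.ext fun X hX => ?_⟩
  rw [Measure.map_apply (continuous_signAct σ).measurable hX,
    ← Set.image_eq_preimage_of_inverse (signAct_signAct σ) (signAct_signAct σ)]
  exact (hν X hX).1 σ

/-- Transpositions suffice for the moment computation. Their action is an involution, so images are
preimages. -/
theorem IsSymmetric.measurePreserving_permAct_swap {K : ℕ} {ν : Measure (Sph K)}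
    (hν : IsSymmetric ν) (a b : Fin K) :
    MeasurePreserving (permAct (Equiv.swap a b)) ν ν := by
  refine ⟨(continuous_permAct _).measurable, Measure.ext fun X hX => ?_⟩
  rw [Measure.map_apply (continuous_permAct _).measurable hX,
    ← Set.image_eq_preimage_of_inverse (permAct_swap_permAct_swap a b)
      (permAct_swap_permAct_swap a b)]
  exact (hν X hX).2 _

/-- The coefficients on the sphere whose entry of largest modulus is the `i`-th one, strictly. -/
def dominant {K : ℕ} (i : Fin K) : Set (Sph K) :=
  {z | ∀ j, j ≠ i → |(z : EuclideanSpace ℝ (Fin K)) j| < |(z : EuclideanSpace ℝ (Fin K)) i|}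

theorem isOpen_dominant {K : ℕ} (i : Fin K) : IsOpen (dominant i) := by
  have : dominant i = ⋂ j : Fin K, ⋂ _ : j ≠ i,
      {z : Sph K | |(z : EuclideanSpace ℝ (Fin K)) j| < |(z : EuclideanSpace ℝ (Fin K)) i|} := by
    ext z; simp [dominant]
  rw [this]
  exact isOpen_iInter_of_finite fun j => isOpen_iInter_of_finite fun _ =>
    isOpen_lt (continuous_coord j).abs (continuous_coord i).abs

theorem measurableSet_dominant {K : ℕ} (i : Fin K) : MeasurableSet (dominant i) :=
  (isOpen_dominant i).measurableSet

theorem notMem_dominant_of_ne {K : ℕ} {i j : Fin K} (hij : j ≠ i) {z : Sph K}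
    (hz : z ∈ dominant i) : z ∉ dominant j :=
  fun h => lt_asymm (hz j hij) (h i hij.symm)

theorem permAct_mem_dominant {K : ℕ} (p : Equiv.Perm (Fin K)) (z : Sph K) (i : Fin K) :
    permAct p z ∈ dominant i ↔ z ∈ dominant (p i) := by
  simp only [dominant, Set.mem_ofPred_eq, permAct_apply]
  refine ⟨fun h j hj => ?_, fun h j hj => h _ (p.injective.ne hj)⟩
  have := h (p.symm j) (fun h' => hj (by rw [← h', Equiv.apply_symm_apply]))
  rwa [Equiv.apply_symm_apply] at this

theorem sum_coord_sq {K : ℕ} (z : Sph K) : ∑ k, (z : EuclideanSpace ℝ (Fin K)) k ^ 2 = 1 := by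
  have h : ‖(z : EuclideanSpace ℝ (Fin K))‖ ^ 2 = 1 := by rw [norm_eq_of_mem_sphere z, one_pow]
  rw [EuclideanSpace.norm_sq_eq] at h
  simpa using h

theorem coord_sq_le_one {K : ℕ} (z : Sph K) (k : Fin K) :
    (z : EuclideanSpace ℝ (Fin K)) k ^ 2 ≤ 1 := by
  refine le_of_le_of_eq ?_ (sum_coord_sq z)
  exact Finset.single_le_sum (f := fun k => (z : EuclideanSpace ℝ (Fin K)) k ^ 2)
    (fun _ _ => sq_nonneg _) (Finset.mem_univ k)

/-- The second moment of the `k`-th coordinate on the event that the `i`-th one dominates. -/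
noncomputable def domMoment {K : ℕ} (ν : Measure (Sph K)) (i k : Fin K) : ℝ :=
  ∫ z, (dominant i).indicator (fun z : Sph K => (z : EuclideanSpace ℝ (Fin K)) k ^ 2) z ∂ν

theorem measurable_indicator_coord {K : ℕ} (i k : Fin K) :
    Measurable ((dominant i).indicator (fun z : Sph K => (z : EuclideanSpace ℝ (Fin K)) k ^ 2)) :=
  ((continuous_coord k).pow 2).measurable.indicator (measurableSet_dominant i)

theorem integrable_indicator_coord {K : ℕ} (ν : Measure (Sph K)) [IsFiniteMeasure ν]
    (i k : Fin K) : Integrable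
      ((dominant i).indicator (fun z : Sph K => (z : EuclideanSpace ℝ (Fin K)) k ^ 2)) ν := by
  refine Integrable.of_bound (measurable_indicator_coord i k).aestronglyMeasurable 1
    (Filter.Eventually.of_forall fun z => ?_)
  by_cases h : z ∈ dominant i
  · rw [Set.indicator_of_mem h, Real.norm_eq_abs, abs_of_nonneg (sq_nonneg _)]
    exact coord_sq_le_one z k
  · rw [Set.indicator_of_notMem h]; simp

/-- Equivariance under transpositions; it forces the moment matrix to have one diagonal value and
one off-diagonal value. -/
theorem domMoment_swap {K : ℕ} {ν : Measure (Sph K)} (hν : IsSymmetric ν) (a b i k : Fin K) :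
    domMoment ν (Equiv.swap a b i) (Equiv.swap a b k) = domMoment ν i k := by
  have h := hν.measurePreserving_permAct_swap a b
  unfold domMoment
  conv_rhs => rw [← h.map_eq]
  rw [integral_map h.aemeasurable (measurable_indicator_coord i k).aestronglyMeasurable]
  refine integral_congr_ae (Filter.Eventually.of_forall fun z => ?_)
  beta_reduce
  by_cases hz : z ∈ dominant (Equiv.swap a b i)
  · rw [Set.indicator_of_mem hz, Set.indicator_of_mem ((permAct_mem_dominant _ _ _).2 hz),
      permAct_apply]
  · rw [Set.indicator_of_notMem hz,
      Set.indicator_of_notMem (fun h => hz ((permAct_mem_dominant _ _ _).1 h))]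

theorem domMoment_self {K : ℕ} {ν : Measure (Sph K)} (hν : IsSymmetric ν) (i j : Fin K) :
    domMoment ν i i = domMoment ν j j := by
  rw [← domMoment_swap hν i j i i, Equiv.swap_apply_left]

theorem domMoment_off {K : ℕ} {ν : Measure (Sph K)} (hν : IsSymmetric ν) {i k l : Fin K}
    (hk : k ≠ i) (hl : l ≠ i) : domMoment ν i k = domMoment ν i l := by
  rw [← domMoment_swap hν k l i k, Equiv.swap_apply_left,
    Equiv.swap_apply_of_ne_of_ne hk.symm hl.symm]

theorem sum_domMoment_row {K : ℕ} {ν : Measure (Sph K)} (hν : IsSymmetric ν) (i j : Fin K) :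
    ∑ k, domMoment ν i k = ∑ k, domMoment ν j k := by
  rw [← Equiv.sum_comp (Equiv.swap i j) fun k => domMoment ν j k]
  refine Finset.sum_congr rfl fun k _ => ?_
  conv_rhs => rw [← domMoment_swap hν i j, Equiv.swap_apply_right, Equiv.swap_apply_self]

theorem measureReal_dominant {K : ℕ} {ν : Measure (Sph K)} [IsFiniteMeasure ν] (i : Fin K) :
    ∑ k, domMoment ν i k = ν.real (dominant i) := by
  unfold domMoment
  rw [← integral_finsetSum _ fun k _ => integrable_indicator_coord ν i k,
    ← integral_indicator_one (measurableSet_dominant i)]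
  refine integral_congr_ae (Filter.Eventually.of_forall fun z => ?_)
  by_cases h : z ∈ dominant i <;> simp [h, sum_coord_sq]

theorem sum_dominant_eq {K : ℕ} {z : Sph K} {i : Fin K} (hz : z ∈ dominant i)
    (f : Fin K → Sph K → ℝ) : ∑ j, (dominant j).indicator (f j) z = f i z := by
  rw [Finset.sum_eq_single i]
  · exact Set.indicator_of_mem hz _
  · exact fun j _ hj => Set.indicator_of_notMem (notMem_dominant_of_ne hj hz) _
  · simp

theorem sum_domMoment {K : ℕ} {ν : Measure (Sph K)} [IsProbabilityMeasure ν]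
    (hdom : ∀ᵐ z ∂ν, ∃ i, z ∈ dominant i) : ∑ i, ∑ k, domMoment ν i k = 1 := by
  have h1 : ∀ i, ∑ k, domMoment ν i k = ∫ z, (dominant i).indicator (fun _ => (1 : ℝ)) z ∂ν := by
    intro i
    rw [measureReal_dominant, ← integral_indicator_one (measurableSet_dominant i)]
    rfl
  simp only [h1]
  rw [← integral_finsetSum _ fun i _ =>
    (integrable_const (1 : ℝ)).indicator (measurableSet_dominant i)]
  have h2 : (fun z => ∑ i, (dominant i).indicator (fun _ => (1 : ℝ)) z) =ᵐ[ν] fun _ => 1 := by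
    filter_upwards [hdom] with z hz
    obtain ⟨i, hi⟩ := hz
    exact sum_dominant_eq hi fun _ _ => 1
  rw [integral_congr_ae h2]
  simp

/-- `WithLp.ofLp` forgets the Euclidean norm, so the left side is the maximum norm. -/
theorem norm_ofLp_of_mem_dominant {K : ℕ} {z : Sph K} {i : Fin K} (hz : z ∈ dominant i) :
    ‖WithLp.ofLp (z : EuclideanSpace ℝ (Fin K))‖ = |(z : EuclideanSpace ℝ (Fin K)) i| := by
  refine le_antisymm ((pi_norm_le_iff_of_nonneg (abs_nonneg _)).2 fun j => ?_)
    (norm_le_pi_norm (WithLp.ofLp (z : EuclideanSpace ℝ (Fin K))) i)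
  rcases eq_or_ne j i with rfl | hj
  · exact le_rfl
  · exact (hz j hj).le

theorem sum_domMoment_self {K : ℕ} {ν : Measure (Sph K)} [IsProbabilityMeasure ν]
    (hdom : ∀ᵐ z ∂ν, ∃ i, z ∈ dominant i) :
    ∑ i, domMoment ν i i = ∫ z : Sph K, ‖WithLp.ofLp (z : EuclideanSpace ℝ (Fin K))‖ ^ 2 ∂ν := by
  unfold domMoment
  rw [← integral_finsetSum _ fun i _ => integrable_indicator_coord ν i i]
  refine integral_congr_ae ?_
  filter_upwards [hdom] with z hz
  obtain ⟨i, hi⟩ := hz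
  rw [norm_ofLp_of_mem_dominant hi, sq_abs]
  exact sum_dominant_eq hi fun i z => (z : EuclideanSpace ℝ (Fin K)) i ^ 2

section Moments

variable {K : ℕ} {ν : Measure (Sph K)} [IsProbabilityMeasure ν] {m : ℝ}

theorem domMoment_self_eq (hK : 2 ≤ K) (hν : IsSymmetric ν)
    (hdom : ∀ᵐ z ∂ν, ∃ i, z ∈ dominant i)
    (hm : m = ∫ z : Sph K, ‖WithLp.ofLp (z : EuclideanSpace ℝ (Fin K))‖ ^ 2 ∂ν) (i : Fin K) :
    domMoment ν i i = m / K := by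
  have h := sum_domMoment_self hdom
  rw [Finset.sum_congr rfl fun j _ => domMoment_self hν j i, ← hm] at h
  simp only [Finset.sum_const, Finset.card_univ, Fintype.card_fin, nsmul_eq_mul] at h
  have : (K : ℝ) ≠ 0 := by positivity
  rw [← h]; field_simp

theorem domMoment_off_eq (hK : 2 ≤ K) (hν : IsSymmetric ν)
    (hdom : ∀ᵐ z ∂ν, ∃ i, z ∈ dominant i)
    (hm : m = ∫ z : Sph K, ‖WithLp.ofLp (z : EuclideanSpace ℝ (Fin K))‖ ^ 2 ∂ν) {i k : Fin K}
    (hk : k ≠ i) : domMoment ν i k = (1 - m) / (K * (K - 1)) := by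
  have hK' : (2 : ℝ) ≤ K := by exact_mod_cast hK
  have h := sum_domMoment hdom
  rw [Finset.sum_congr rfl fun j _ => sum_domMoment_row hν j i] at h
  rw [Finset.sum_const, Finset.card_univ, Fintype.card_fin, nsmul_eq_mul,
    ← Finset.add_sum_erase _ _ (Finset.mem_univ i), domMoment_self_eq hK hν hdom hm,
    Finset.sum_congr rfl fun l hl => domMoment_off hν (Finset.ne_of_mem_erase hl) hk,
    Finset.sum_const, Finset.card_erase_of_mem (Finset.mem_univ i), Finset.card_univ,
    Fintype.card_fin, nsmul_eq_mul, Nat.cast_sub (by omega), Nat.cast_one] at h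
  have h0 : (K : ℝ) ≠ 0 := by positivity
  have h1 : (K : ℝ) - 1 ≠ 0 := by linarith
  field_simp
  field_simp at h
  linarith

/-- The dominant coefficient carries more than the average energy. -/
theorem moment_gap_pos (hK : 2 ≤ K) (hdom : ∀ᵐ z ∂ν, ∃ i, z ∈ dominant i)
    (hm : m = ∫ z : Sph K, ‖WithLp.ofLp (z : EuclideanSpace ℝ (Fin K))‖ ^ 2 ∂ν) :
    0 < m - (1 - m) / ((K : ℝ) - 1) ∧ m ≤ 1 := by
  have hK' : (2 : ℝ) ≤ K := by exact_mod_cast hK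
  have hle : ∀ᵐ z : Sph K ∂ν, ‖WithLp.ofLp (z : EuclideanSpace ℝ (Fin K))‖ ^ 2 ≤ 1 := by
    filter_upwards [hdom] with z ⟨i, hi⟩
    rw [norm_ofLp_of_mem_dominant hi, sq_abs]
    exact coord_sq_le_one z i
  have hcont : Continuous fun z : Sph K => ‖WithLp.ofLp (z : EuclideanSpace ℝ (Fin K))‖ ^ 2 := by
    fun_prop
  have hint : Integrable (fun z : Sph K => ‖WithLp.ofLp (z : EuclideanSpace ℝ (Fin K))‖ ^ 2) ν := by
    refine Integrable.of_bound hcont.aestronglyMeasurable 1 ?_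
    filter_upwards [hle] with z hz
    rwa [Real.norm_eq_abs, abs_of_nonneg (sq_nonneg _)]
  -- The squares sum to one and the largest is strictly dominant, hence above the average `1 / K`.
  have hgt : ∀ᵐ z : Sph K ∂ν,
      0 < ‖WithLp.ofLp (z : EuclideanSpace ℝ (Fin K))‖ ^ 2 - (K : ℝ)⁻¹ := by
    filter_upwards [hdom] with z ⟨i, hi⟩
    rw [norm_ofLp_of_mem_dominant hi, sq_abs]
    have h1 : ∑ k, (z : EuclideanSpace ℝ (Fin K)) k ^ 2
        < ∑ _k : Fin K, (z : EuclideanSpace ℝ (Fin K)) i ^ 2 := by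
      have : Nontrivial (Fin K) := Fin.nontrivial_iff_two_le.2 hK
      obtain ⟨j, hj⟩ := exists_ne i
      refine Finset.sum_lt_sum (fun k _ => ?_) ⟨j, Finset.mem_univ j, sq_lt_sq.2 (hi j hj)⟩
      rcases eq_or_ne k i with rfl | hk
      · exact le_rfl
      · exact (sq_lt_sq.2 (hi k hk)).le
    rw [sum_coord_sq, Finset.sum_const, Finset.card_univ, Fintype.card_fin, nsmul_eq_mul] at h1
    rw [sub_pos, inv_lt_iff_one_lt_mul₀ (by positivity)]
    linarith
  have hpos : 0 < ∫ z : Sph K, (‖WithLp.ofLp (z : EuclideanSpace ℝ (Fin K))‖ ^ 2 - (K : ℝ)⁻¹) ∂ν := by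
    rw [integral_pos_iff_support_of_nonneg_ae (hgt.mono fun z hz => hz.le)
      (hint.sub (integrable_const _))]
    have h1 : Function.support (fun z : Sph K =>
        ‖WithLp.ofLp (z : EuclideanSpace ℝ (Fin K))‖ ^ 2 - (K : ℝ)⁻¹) =ᵐ[ν] Set.univ :=
      Filter.eventuallyEq_univ.2 (hgt.mono fun z hz => hz.ne')
    rw [measure_congr h1, measure_univ]
    exact one_pos
  rw [integral_sub hint (integrable_const _), ← hm] at hpos
  simp only [integral_const, probReal_univ, one_smul] at hpos
  refine ⟨?_, ?_⟩
  · have h1 : m - (1 - m) / ((K : ℝ) - 1) = K * (m - (K : ℝ)⁻¹) / (K - 1) := by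
      have : (K : ℝ) - 1 ≠ 0 := by linarith
      field_simp
      ring
    rw [h1]
    have : 0 < (K : ℝ) - 1 := by linarith
    positivity
  · rw [hm]
    calc _ ≤ ∫ _z : Sph K, (1 : ℝ) ∂ν := integral_mono_ae hint (integrable_const _) hle
      _ = 1 := by simp

end Moments

/-! ### Expectations over coefficients and noise -/

theorem continuous_synth {d K : ℕ} (Φ : Dict d K) : Continuous (synth Φ) := by
  unfold synth
  fun_prop

theorem continuous_norm_analysis_sq {d K : ℕ} (Ψ : Dict d K) :
    Continuous fun y => ‖analysis Ψ y‖ ^ 2 := by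
  unfold analysis
  fun_prop

theorem norm_analysis_le {d K : ℕ} (Ψ : Dict d K) (y : EuclideanSpace ℝ (Fin d)) :
    ‖analysis Ψ y‖ ≤ ‖Ψ‖ * ‖y‖ :=
  (pi_norm_le_iff_of_nonneg (by positivity)).2 fun i => (abs_real_inner_le_norm (Ψ i) y).trans
    (mul_le_mul_of_nonneg_right (norm_le_pi_norm Ψ i) (norm_nonneg y))

/-- Coefficients and noise, jointly. -/
abbrev Sample (d K : ℕ) : Type := Sph K × EuclideanSpace ℝ (Fin d)

/-- `‖Ψ* (Φ z + w)‖_∞²` as a function of coefficients and noise. -/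
noncomputable def response {d K : ℕ} (Φ Ψ : Dict d K) (q : Sample d K) : ℝ :=
  ‖analysis Ψ (synth Φ (q.1 : EuclideanSpace ℝ (Fin K)) + q.2)‖ ^ 2

theorem continuous_response {d K : ℕ} (Φ Ψ : Dict d K) : Continuous (response Φ Ψ) :=
  (continuous_norm_analysis_sq Ψ).comp
    (((continuous_synth Φ).comp (continuous_subtype_val.comp continuous_fst)).add continuous_snd)

theorem response_le {d K : ℕ} (Φ Ψ : Dict d K) {A ρ : ℝ} (hA : IsTightFrame Φ A)
    {q : Sample d K} (hq : ‖q.2‖ ≤ ρ) :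
    ‖response Φ Ψ q‖ ≤ (‖Ψ‖ * (√A + ρ)) ^ 2 := by
  have h1 : ‖synth Φ (q.1 : EuclideanSpace ℝ (Fin K))‖ ≤ √A := by
    refine Real.le_sqrt_of_sq_le ?_
    have := norm_synth_sq_le hA (q.1 : EuclideanSpace ℝ (Fin K))
    rwa [norm_eq_of_mem_sphere q.1, one_pow, mul_one] at this
  rw [response, Real.norm_eq_abs, abs_of_nonneg (sq_nonneg _)]
  gcongr
  refine (norm_analysis_le _ _).trans ?_
  gcongr
  exact (norm_add_le _ _).trans (add_le_add h1 hq)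

theorem ae_prod_snd_le {d K : ℕ} {ν : Measure (Sph K)} {τ : Measure (EuclideanSpace ℝ (Fin d))}
    {ρ : ℝ} (hτ : ∀ᵐ w ∂τ, ‖w‖ ≤ ρ) : ∀ᵐ q ∂ν.prod τ, ‖q.2‖ ≤ ρ :=
  Measure.quasiMeasurePreserving_snd.ae hτ

theorem ae_prod_decay {d K : ℕ} {ν : Measure (Sph K)}
    {τ : Measure (EuclideanSpace ℝ (Fin d))} {μ ρ β : ℝ}
    (hdec : ∀ᵐ z : Sph K ∂ν, ∃ i c, DecayAt μ ρ β (z : EuclideanSpace ℝ (Fin K)) i c)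
    (hτ : ∀ᵐ w ∂τ, ‖w‖ ≤ ρ) : ∀ᵐ q : Sample d K ∂ν.prod τ,
      (∃ i c, DecayAt μ ρ β (q.1 : EuclideanSpace ℝ (Fin K)) i c) ∧ ‖q.2‖ ≤ ρ :=
  (Measure.quasiMeasurePreserving_fst.ae hdec).and (ae_prod_snd_le hτ)

theorem DecayAt.mem_dominant {K : ℕ} {μ ρ β : ℝ} {z : Sph K} {i : Fin K} {c : ℝ}
    (h : DecayAt μ ρ β (z : EuclideanSpace ℝ (Fin K)) i c) : z ∈ dominant i :=
  fun j hj => (h.le j hj).trans_lt h.lt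

section Joint

variable {d K : ℕ} {ν : Measure (Sph K)} [IsProbabilityMeasure ν]
  {τ : Measure (EuclideanSpace ℝ (Fin d))} [IsProbabilityMeasure τ] {ρ : ℝ}

theorem integrable_response (Φ Ψ : Dict d K) {A : ℝ} (hA : IsTightFrame Φ A)
    (hτ : ∀ᵐ w ∂τ, ‖w‖ ≤ ρ) : Integrable (response Φ Ψ) (ν.prod τ) :=
  Integrable.of_bound (continuous_response Φ Ψ).aestronglyMeasurable _
    ((ae_prod_snd_le hτ).mono fun _ hq => response_le Φ Ψ hA hq)

theorem measurePreserving_sign_prod (hν : IsSymmetric ν) (σ : Fin K → ℤˣ) :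
    MeasurePreserving (Prod.map (signAct σ) (id : EuclideanSpace ℝ (Fin d) → _))
      (ν.prod τ) (ν.prod τ) :=
  (hν.measurePreserving_signAct σ).prod (MeasurePreserving.id τ)

/-- Averaging over the signs does not change the expectation. -/
theorem integral_sum_signs_response (hν : IsSymmetric ν) (Φ Ψ : Dict d K) {A : ℝ}
    (hA : IsTightFrame Φ A) (hτ : ∀ᵐ w ∂τ, ‖w‖ ≤ ρ) :
    Integrable (fun q => ∑ σ : Fin K → ℤˣ, response Φ Ψ (signAct σ q.1, q.2)) (ν.prod τ) ∧
    ∫ q, ∑ σ : Fin K → ℤˣ, response Φ Ψ (signAct σ q.1, q.2) ∂ν.prod τ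
      = 2 ^ K * ∫ q, response Φ Ψ q ∂ν.prod τ := by
  have hint := integrable_response (ν := ν) (τ := τ) Φ Ψ hA hτ
  have hi : ∀ σ : Fin K → ℤˣ, Integrable
      (fun q : Sample d K => response Φ Ψ (signAct σ q.1, q.2)) (ν.prod τ) := fun σ =>
    (measurePreserving_sign_prod hν σ).integrable_comp_of_integrable hint
  refine ⟨integrable_finsetSum _ fun σ _ => hi σ, ?_⟩
  rw [integral_finsetSum _ fun σ _ => hi σ]
  have he : ∀ σ : Fin K → ℤˣ, ∫ q : Sample d K, response Φ Ψ (signAct σ q.1, q.2) ∂ν.prod τ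
      = ∫ q, response Φ Ψ q ∂ν.prod τ := by
    intro σ
    have h := measurePreserving_sign_prod (τ := τ) hν σ
    conv_rhs => rw [← h.map_eq]
    rw [integral_map h.aemeasurable (continuous_response Φ Ψ).aestronglyMeasurable]
    rfl
  simp only [he, Finset.sum_const, Finset.card_univ, nsmul_eq_mul, card_signs]

/-- The sign average of `⟨ψ_i, y⟩²`, where `i` is the dominant index. -/
noncomputable def dominantResponse (Φ Ψ : Dict d K) (q : Sample d K) : ℝ :=
  ∑ i, (dominant i).indicator (fun z : Sph K =>
    ∑ k, (z : EuclideanSpace ℝ (Fin K)) k ^ 2 * inner ℝ (Ψ i) (Φ k) ^ 2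
      + inner ℝ (Ψ i) q.2 ^ 2) q.1

theorem dominantResponse_of_mem (Φ Ψ : Dict d K) {q : Sample d K} {i : Fin K}
    (hi : q.1 ∈ dominant i) : dominantResponse Φ Ψ q =
      ∑ k, (q.1 : EuclideanSpace ℝ (Fin K)) k ^ 2 * inner ℝ (Ψ i) (Φ k) ^ 2
        + inner ℝ (Ψ i) q.2 ^ 2 :=
  sum_dominant_eq hi fun i z => ∑ k, (z : EuclideanSpace ℝ (Fin K)) k ^ 2 * inner ℝ (Ψ i) (Φ k) ^ 2
      + inner ℝ (Ψ i) q.2 ^ 2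

theorem integral_dominantResponse (Φ Ψ : Dict d K) (hΨ : Ψ ∈ admissible d K)
    (hτ : ∀ᵐ w ∂τ, ‖w‖ ≤ ρ) {s : ℝ}
    (hcov : ∀ v : EuclideanSpace ℝ (Fin d), ∫ w, inner ℝ v w ^ 2 ∂τ = s ^ 2 * ‖v‖ ^ 2) :
    Integrable (dominantResponse Φ Ψ) (ν.prod τ) ∧
    ∫ q, dominantResponse Φ Ψ q ∂ν.prod τ
      = ∑ i, ∑ k, domMoment ν i k * inner ℝ (Ψ i) (Φ k) ^ 2
        + ∑ i, ν.real (dominant i) * s ^ 2 := by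
  -- Each summand is a function of the coefficients times a function of the noise, so the product
  -- integral factors.
  have hform : dominantResponse Φ Ψ = fun q : Sample d K =>
      ∑ i, (∑ k, (dominant i).indicator (fun z : Sph K => (z : EuclideanSpace ℝ (Fin K)) k ^ 2) q.1
          * inner ℝ (Ψ i) (Φ k) ^ 2
        + (dominant i).indicator (fun _ => (1 : ℝ)) q.1 * inner ℝ (Ψ i) q.2 ^ 2) := by
    funext q
    refine Finset.sum_congr rfl fun i _ => ?_
    by_cases h : q.1 ∈ dominant i <;> simp [h]
  have hw : ∀ v : EuclideanSpace ℝ (Fin d), Integrable (fun w => inner ℝ v w ^ 2) τ := by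
    intro v
    refine Integrable.of_bound (Continuous.aestronglyMeasurable (by fun_prop)) ((‖v‖ * ρ) ^ 2) ?_
    filter_upwards [hτ] with w hw
    rw [Real.norm_eq_abs, abs_of_nonneg (sq_nonneg _), ← sq_abs]
    gcongr
    exact (abs_real_inner_le_norm v w).trans (by gcongr)
  have h1 : ∀ i k, Integrable (fun q : Sample d K => (dominant i).indicator
      (fun z : Sph K => (z : EuclideanSpace ℝ (Fin K)) k ^ 2) q.1 * inner ℝ (Ψ i) (Φ k) ^ 2)
      (ν.prod τ) := fun i k =>
    (integrable_indicator_coord ν i k).mul_prod (integrable_const (inner ℝ (Ψ i) (Φ k) ^ 2))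
  have h2 : ∀ i, Integrable (fun q : Sample d K => (dominant i).indicator
      (fun _ => (1 : ℝ)) q.1 * inner ℝ (Ψ i) q.2 ^ 2) (ν.prod τ) := fun i =>
    ((integrable_const (1 : ℝ)).indicator (measurableSet_dominant i)).mul_prod (hw (Ψ i))
  have h3 : ∀ i, Integrable (fun q : Sample d K => ∑ k, (dominant i).indicator
      (fun z : Sph K => (z : EuclideanSpace ℝ (Fin K)) k ^ 2) q.1 * inner ℝ (Ψ i) (Φ k) ^ 2)
      (ν.prod τ) := fun i => integrable_finsetSum _ fun k _ => h1 i k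
  have h4 : ∀ i, Integrable (fun q : Sample d K =>
      ∑ k, (dominant i).indicator (fun z : Sph K => (z : EuclideanSpace ℝ (Fin K)) k ^ 2) q.1
          * inner ℝ (Ψ i) (Φ k) ^ 2
        + (dominant i).indicator (fun _ => (1 : ℝ)) q.1 * inner ℝ (Ψ i) q.2 ^ 2) (ν.prod τ) :=
    fun i => (h3 i).add (h2 i)
  rw [hform]
  refine ⟨integrable_finsetSum _ fun i _ => h4 i, ?_⟩
  rw [integral_finsetSum _ fun i _ => h4 i, ← Finset.sum_add_distrib]
  refine Finset.sum_congr rfl fun i _ => ?_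
  rw [integral_add (h3 i) (h2 i), integral_finsetSum _ fun k _ => h1 i k]
  congr 1
  · refine Finset.sum_congr rfl fun k _ => ?_
    have := integral_prod_mul (μ := ν) (ν := τ) ((dominant i).indicator
      (fun z : Sph K => (z : EuclideanSpace ℝ (Fin K)) k ^ 2))
      (fun _ => inner ℝ (Ψ i) (Φ k) ^ 2)
    rw [this]
    simp [domMoment]
  · have := integral_prod_mul (μ := ν) (ν := τ) ((dominant i).indicator (fun _ => (1 : ℝ)))
      (fun w => inner ℝ (Ψ i) w ^ 2)
    rw [this, hcov, hΨ i, one_pow, mul_one]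
    congr 1
    exact integral_indicator_one (measurableSet_dominant i)

variable {μ β A s : ℝ}

theorem le_integral_response (hν : IsSymmetric ν) (Φ Ψ : Dict d K) (hΨ : Ψ ∈ admissible d K)
    (hA : IsTightFrame Φ A) (hτ : ∀ᵐ w ∂τ, ‖w‖ ≤ ρ)
    (hcov : ∀ v : EuclideanSpace ℝ (Fin d), ∫ w, inner ℝ v w ^ 2 ∂τ = s ^ 2 * ‖v‖ ^ 2)
    (hdec : ∀ᵐ z : Sph K ∂ν, ∃ i c, DecayAt μ ρ β (z : EuclideanSpace ℝ (Fin K)) i c) :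
    ∫ q, dominantResponse Φ Ψ q ∂ν.prod τ ≤ ∫ q, response Φ Ψ q ∂ν.prod τ := by
  obtain ⟨hi, he⟩ := integral_sum_signs_response (ν := ν) hν Φ Ψ hA hτ
  have h1 := (integral_dominantResponse (ν := ν) Φ Ψ hΨ hτ hcov).1
  have h2 : ∫ q, 2 ^ K * dominantResponse Φ Ψ q ∂ν.prod τ
      ≤ ∫ q, ∑ σ : Fin K → ℤˣ, response Φ Ψ (signAct σ q.1, q.2) ∂ν.prod τ := by
    refine integral_mono_ae (h1.const_mul _) hi ?_
    filter_upwards [ae_prod_decay (τ := τ) hdec hτ] with q hq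
    obtain ⟨⟨i, c, hz⟩, -⟩ := hq
    rw [dominantResponse_of_mem Φ Ψ hz.mem_dominant]
    exact le_sum_signs_analysis Φ Ψ q.1 i q.2
  rw [he, integral_const_mul] at h2
  exact le_of_mul_le_mul_left h2 (by positivity)

theorem integral_response_le (hν : IsSymmetric ν) {Φ Ψ : Dict d K} {e : ℝ} (hμ0 : 0 ≤ μ)
    (hA : IsTightFrame Φ A) (hA1 : 1 ≤ A)
    (hΦ : Φ ∈ admissible d K) (hΨ : Ψ ∈ admissible d K)
    (hμ : ∀ j k, j ≠ k → |inner ℝ (Φ j) (Φ k)| ≤ μ)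
    (hd : ∀ j, ‖Ψ j - Φ j‖ ≤ e) (hβ0 : 0 ≤ β) (hβ : β < 1 / 2)
    (he0 : 0 < e) (he : e < 1 / 5) (heβ : e ≤ (1 - 2 * β) ^ 2 / 2)
    (hτ : ∀ᵐ w ∂τ, ‖w‖ ≤ ρ)
    (hcov : ∀ v : EuclideanSpace ℝ (Fin d), ∫ w, inner ℝ v w ^ 2 ∂τ = s ^ 2 * ‖v‖ ^ 2)
    (hdec : ∀ᵐ z : Sph K ∂ν, ∃ i c, DecayAt μ ρ β (z : EuclideanSpace ℝ (Fin K)) i c) :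
    ∫ q, response Φ Ψ q ∂ν.prod τ
      ≤ ∫ q, dominantResponse Φ Ψ q ∂ν.prod τ + excess A β e K := by
  obtain ⟨hi, hs⟩ := integral_sum_signs_response (ν := ν) hν Φ Ψ hA hτ
  have h1 := (integral_dominantResponse (ν := ν) Φ Ψ hΨ hτ hcov).1
  have h2 : ∫ q, ∑ σ : Fin K → ℤˣ, response Φ Ψ (signAct σ q.1, q.2) ∂ν.prod τ
      ≤ ∫ q, 2 ^ K * (dominantResponse Φ Ψ q + excess A β e K) ∂ν.prod τ := by
    refine integral_mono_ae hi ((h1.add (integrable_const _)).const_mul _) ?_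
    filter_upwards [ae_prod_decay (τ := τ) hdec hτ] with q hq
    obtain ⟨⟨i, c, hz⟩, hw⟩ := hq
    rw [dominantResponse_of_mem Φ Ψ hz.mem_dominant]
    exact sum_signs_analysis_le hμ0 hA hA1 hΦ hΨ hμ hd hβ0 hβ he0 he heβ
      (norm_eq_of_mem_sphere q.1) hz hw
  rw [hs, integral_const_mul, integral_add h1 (integrable_const _)] at h2
  simp only [integral_const, probReal_univ, one_smul] at h2
  exact le_of_mul_le_mul_left h2 (by positivity)

/-- The energy lost by replacing the dominant atoms of `Φ` with those of `Ψ`. -/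
theorem integral_dominantResponse_sub (hK : 2 ≤ K) (hν : IsSymmetric ν) {m : ℝ}
    (hm : m = ∫ z : Sph K, ‖WithLp.ofLp (z : EuclideanSpace ℝ (Fin K))‖ ^ 2 ∂ν)
    {Φ Ψ : Dict d K} (hA : IsTightFrame Φ A)
    (hΦ : Φ ∈ admissible d K) (hΨ : Ψ ∈ admissible d K) (hτ : ∀ᵐ w ∂τ, ‖w‖ ≤ ρ)
    (hcov : ∀ v : EuclideanSpace ℝ (Fin d), ∫ w, inner ℝ v w ^ 2 ∂τ = s ^ 2 * ‖v‖ ^ 2)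
    (hdom : ∀ᵐ z ∂ν, ∃ i, z ∈ dominant i) :
    ∫ q, dominantResponse Φ Φ q ∂ν.prod τ - ∫ q, dominantResponse Φ Ψ q ∂ν.prod τ
      = (m - (1 - m) / ((K : ℝ) - 1)) / K *
        ∑ i, (‖Ψ i - Φ i‖ ^ 2 - ‖Ψ i - Φ i‖ ^ 4 / 4) := by
  have hK' : (2 : ℝ) ≤ K := by exact_mod_cast hK
  -- All off-diagonal moments in the row agree, so tightness replaces the sum over `k ≠ i` by `A -
  -- ⟨θ_i, φ_i⟩²`.
  have row : ∀ (Θ : Dict d K), Θ ∈ admissible d K → ∀ i,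
      ∑ k, domMoment ν i k * inner ℝ (Θ i) (Φ k) ^ 2
        = (1 - m) / (K * (K - 1)) * A
          + (m / K - (1 - m) / (K * (K - 1))) * inner ℝ (Θ i) (Φ i) ^ 2 := by
    intro Θ hΘ i
    have h1 : ∑ k, inner ℝ (Θ i) (Φ k) ^ 2 = A := by
      have := hA.2 (Θ i)
      rw [hΘ i, one_pow, mul_one] at this
      rw [← this]
      exact Finset.sum_congr rfl fun k _ => by rw [sq_abs, real_inner_comm]
    rw [← Finset.add_sum_erase _ _ (Finset.mem_univ i)] at h1 ⊢
    rw [domMoment_self_eq hK hν hdom hm, Finset.sum_congr rfl fun k hk => by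
      rw [domMoment_off_eq hK hν hdom hm (Finset.ne_of_mem_erase hk)], ← Finset.mul_sum, ← h1]
    ring
  rw [(integral_dominantResponse (ν := ν) Φ Φ hΦ hτ hcov).2,
    (integral_dominantResponse (ν := ν) Φ Ψ hΨ hτ hcov).2, add_sub_add_right_eq_sub,
    ← Finset.sum_sub_distrib, Finset.mul_sum]
  refine Finset.sum_congr rfl fun i _ => ?_
  rw [row Φ hΦ, row Ψ hΨ, real_inner_self_eq_norm_sq, hΦ i]
  have h2 : inner ℝ (Ψ i) (Φ i) = 1 - ‖Ψ i - Φ i‖ ^ 2 / 2 := by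
    have := inner_sub_self_of_norm_one (hΨ i) (hΦ i)
    rw [inner_sub_left, real_inner_self_eq_norm_sq, hΦ i] at this
    linarith
  rw [h2]
  have : (K : ℝ) - 1 ≠ 0 := by linarith
  field_simp
  ring

end Joint

/-! ### The numerical comparison of gain and loss -/

/-- For `x = 1 / e > 5` the exponent `1.38 * (x - 2)` exceeds `4`, so expanding `exp` to second
order around `4` already beats `1.2 * x ^ 2`. The slack is `9 / 8 < 0.99 * 1.2`, where `0.99`
absorbs `e ^ 4 / 4`. -/
theorem exp_neg_lt_sq {e : ℝ} (he0 : 0 < e) (he : e < 1 / 5) :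
    9 / 8 * Real.exp (-(1.38 * (1 / e - 2))) < e ^ 2 - e ^ 4 / 4 := by
  set x := 1 / e with hx
  have hx5 : 5 < x := by rw [hx, lt_div_iff₀ he0]; linarith
  have hex : e = 1 / x := by rw [hx, one_div_one_div]
  have h1 : 50 * (1 + (1.38 * (x - 2) - 4) + (1.38 * (x - 2) - 4) ^ 2 / 2)
      ≤ Real.exp (1.38 * (x - 2)) := by
    have h2 := Real.quadratic_le_exp_of_nonneg (x := 1.38 * (x - 2) - 4) (by linarith)
    have h3 : (50 : ℝ) ≤ Real.exp 4 := by
      have h4 : Real.exp 4 = Real.exp 1 ^ 4 := by rw [← Real.exp_nat_mul]; norm_num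
      rw [h4]
      calc (50 : ℝ) ≤ 2.7 ^ 4 := by norm_num
        _ ≤ Real.exp 1 ^ 4 := by
          gcongr
          exact (by norm_num : (2.7 : ℝ) ≤ 2.7182818283).trans Real.exp_one_gt_d9.le
    have h5 : Real.exp (1.38 * (x - 2)) = Real.exp 4 * Real.exp (1.38 * (x - 2) - 4) := by
      rw [← Real.exp_add]; ring_nf
    rw [h5]
    exact mul_le_mul h3 h2 (by nlinarith [sq_nonneg (1.38 * (x - 2) - 4)]) (Real.exp_pos _).le
  have h2 : 1.2 * x ^ 2 < Real.exp (1.38 * (x - 2)) := by nlinarith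
  have h3 : 9 / 8 * Real.exp (-(1.38 * (x - 2))) < 0.99 * e ^ 2 := by
    rw [Real.exp_neg, hex, ← div_eq_mul_inv, div_lt_iff₀ (Real.exp_pos _)]
    have h4 : 0.99 * (1 / x) ^ 2 * (1.2 * x ^ 2) = 1.188 := by
      field_simp; norm_num
    have h5 : 0.99 * (1 / x) ^ 2 * (1.2 * x ^ 2)
        < 0.99 * (1 / x) ^ 2 * Real.exp (1.38 * (x - 2)) :=
      mul_lt_mul_of_pos_left h2 (by positivity)
    linarith
  have h4 : e ^ 4 ≤ 0.04 * e ^ 2 := by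
    have : e ^ 2 ≤ 0.04 := by nlinarith
    nlinarith [sq_nonneg e]
  linarith

/-- The ratio is at least `4`, and `log 4 > 1.38`. -/
theorem log_ratio_ge {A g n : ℝ} (hA : 1 ≤ A) (hn : 2 ≤ n) (hg0 : 0 < g) (hg1 : g ≤ 1) :
    1.38 ≤ Real.log (2 * A * n / g) := by
  have h1 : (4 : ℝ) ≤ 2 * A * n / g := by
    rw [le_div_iff₀ hg0]
    nlinarith
  have h2 : Real.log 4 = 2 * Real.log 2 := by
    rw [show (4 : ℝ) = 2 ^ 2 by norm_num, Real.log_pow]; norm_num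
  have h3 := Real.log_le_log (by norm_num) h1
  have := Real.log_two_gt_d9
  linarith

/-- With `L` the logarithm, the hypothesis bounds the Hoeffding factor by `exp (-L / e) = exp (-2 *
L) * exp (-L * (1 / e - 2))`. The first factor `(g / (2 * A * K)) ^ 2` cancels the union bound over
`K` atoms and leaves `g / K * (g / A) * (9 / 8)`; the second is handled by `exp_neg_lt_sq`. -/
theorem excess_lt {A β e g : ℝ} {K : ℕ} (hA : 1 ≤ A) (hK : 2 ≤ K) (hg0 : 0 < g) (hg1 : g ≤ 1)
    (he0 : 0 < e) (he : e < 1 / 5)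
    (heβ : e ≤ (1 - 2 * β) ^ 2 / (2 * A * Real.log (2 * A * K / g))) :
    excess A β e K < g / K * (e ^ 2 - e ^ 4 / 4) := by
  have hn : (2 : ℝ) ≤ K := by exact_mod_cast hK
  have hL := log_ratio_ge hA hn hg0 hg1
  set L := Real.log (2 * A * K / g) with hLdef
  have hL0 : 0 < L := by linarith
  have hA0 : 0 < A := by linarith
  have hθ : Real.exp (-L) = g / (2 * A * K) := by
    rw [hLdef, Real.exp_neg, Real.exp_log (by positivity), inv_div]
  have h1 : Real.exp (-(1 - 2 * β) ^ 2 / (2 * (A * e ^ 2)))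
      ≤ (g / (2 * A * K)) ^ 2 * Real.exp (-(1.38 * (1 / e - 2))) := by
    rw [← hθ, ← Real.exp_nat_mul, ← Real.exp_add]
    refine Real.exp_le_exp.2 ?_
    have h2 : L / e ≤ (1 - 2 * β) ^ 2 / (2 * (A * e ^ 2)) := by
      rw [le_div_iff₀ (by positivity)] at heβ ⊢
      have : L / e * (2 * (A * e ^ 2)) = e * (2 * A * L) := by field_simp
      rw [this]
      exact heβ
    have h3 : 1.38 * (1 / e - 2) ≤ L * (1 / e - 2) := by
      refine mul_le_mul_of_nonneg_right hL ?_
      have : 5 < 1 / e := by rw [lt_div_iff₀ he0]; linarith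
      linarith
    have h4 : L * (1 / e - 2) = L / e - 2 * L := by ring
    rw [neg_div]
    push_cast
    linarith
  have h5 := exp_neg_lt_sq he0 he
  set E := Real.exp (-(1.38 * (1 / e - 2))) with hE
  have hE0 : 0 < E := Real.exp_pos _
  calc excess A β e K
      ≤ 9 / 4 * A * (K * (2 * ((g / (2 * A * K)) ^ 2 * E))) := by
        unfold excess
        gcongr
    _ = g / K * (g / A * (9 / 8 * E)) := by field_simp; ring
    _ ≤ g / K * (1 * (9 / 8 * E)) := by
        gcongr
        exact (div_le_one hA0).2 (hg1.trans hA)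
    _ < g / K * (e ^ 2 - e ^ 4 / 4) := by
        rw [one_mul]
        gcongr

/-! ### Coherence, distance, rearrangement and isotropy of the noise -/

theorem abs_inner_le_coherence {d K : ℕ} (Φ : Dict d K) (j k : Fin K) (h : j ≠ k) :
    |inner ℝ (Φ j) (Φ k)| ≤ coherence Φ :=
  le_ciSup (f := fun p : {p : Fin K × Fin K // p.1 ≠ p.2} => |inner ℝ (Φ p.1.1) (Φ p.1.2)|)
    (Set.finite_range _).bddAbove ⟨(j, k), h⟩

theorem coherence_nonneg {d K : ℕ} (Φ : Dict d K) : 0 ≤ coherence Φ :=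
  Real.iSup_nonneg fun _ => abs_nonneg _

theorem norm_sub_le_dictDist {d K : ℕ} (Ψ Φ : Dict d K) (i : Fin K) :
    ‖Ψ i - Φ i‖ ≤ dictDist Ψ Φ :=
  le_ciSup (f := fun i => ‖Ψ i - Φ i‖) (Set.finite_range _).bddAbove i

theorem dictDist_nonneg {d K : ℕ} (Ψ Φ : Dict d K) : 0 ≤ dictDist Ψ Φ :=
  Real.iSup_nonneg fun _ => norm_nonneg _

theorem dictDist_le_dist {d K : ℕ} (Ψ Φ : Dict d K) : dictDist Ψ Φ ≤ dist Ψ Φ :=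
  Real.iSup_le (fun i => by rw [← dist_eq_norm]; exact dist_le_pi_dist Ψ Φ i) dist_nonneg

theorem exists_norm_sub_eq_dictDist {d K : ℕ} [Nonempty (Fin K)] (Ψ Φ : Dict d K) :
    ∃ i, ‖Ψ i - Φ i‖ = dictDist Ψ Φ :=
  exists_eq_ciSup_of_finite (f := fun i => ‖Ψ i - Φ i‖)

/-- Test the frame identity on an atom and keep only its own term. -/
theorem IsTightFrame.one_le {d K : ℕ} {Φ : Dict d K} {A : ℝ} (hA : IsTightFrame Φ A)
    (hΦ : Φ ∈ admissible d K) (i : Fin K) : 1 ≤ A := by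
  have h := hA.2 (Φ i)
  rw [hΦ i, one_pow, mul_one] at h
  have h1 : |inner ℝ (Φ i) (Φ i)| ^ 2 = (1 : ℝ) := by
    rw [real_inner_self_eq_norm_sq, hΦ i]; simp
  rw [← h, ← h1]
  exact Finset.single_le_sum (f := fun j => |inner ℝ (Φ j) (Φ i)| ^ 2)
    (fun _ _ => sq_nonneg _) (Finset.mem_univ i)

theorem exists_decayAt {K : ℕ} (h0 : 0 < K) (h1 : 1 < K) {μ ρ β : ℝ} {z : EuclideanSpace ℝ (Fin K)}
    (hlt : rearr z ⟨1, h1⟩ < rearr z ⟨0, h0⟩)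
    (hdec : (rearr z ⟨1, h1⟩ + μ * ∑ k, |rearr z k| + ρ)
      / (rearr z ⟨0, h0⟩ - rearr z ⟨1, h1⟩) ≤ β) :
    ∃ i c, DecayAt μ ρ β z i c := by
  set p := Tuple.sort (fun j => -|z j|) with hp
  have hr : ∀ k, rearr z k = |z (p k)| := fun k => rfl
  have hsum : ∑ k, |rearr z k| = ∑ k, |z k| := by
    simp only [hr, abs_abs]
    exact Equiv.sum_comp p fun k => |z k|
  rw [hsum, div_le_iff₀ (sub_pos.2 hlt)] at hdec
  refine ⟨p ⟨0, h0⟩, rearr z ⟨1, h1⟩, ⟨abs_nonneg _, hlt, fun j hj => ?_, hdec⟩⟩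
  have h2 : p.symm j ≠ ⟨0, h0⟩ := fun h => hj (by rw [← h, p.apply_symm_apply])
  -- Every index other than the dominant one has sorted position at least one (zero-based), hence
  -- modulus at most the second largest.
  have h3 : (⟨1, h1⟩ : Fin K) ≤ p.symm j := by
    rw [Fin.le_def]
    have : (p.symm j).val ≠ 0 := fun h => h2 (Fin.ext h)
    exact Nat.one_le_iff_ne_zero.2 this
  have h4 := rearr_antitone z h3
  rwa [hr (p.symm j), p.apply_symm_apply] at h4

theorem DecayAt.beta_nonneg {K : ℕ} {μ ρ β : ℝ} {z : EuclideanSpace ℝ (Fin K)} {i : Fin K} {c : ℝ}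
    (hz : DecayAt μ ρ β z i c) (hμ : 0 ≤ μ) (hρ : 0 ≤ ρ) : 0 ≤ β := by
  have h1 : 0 ≤ μ * ∑ k, |z k| := mul_nonneg hμ (Finset.sum_nonneg fun _ _ => abs_nonneg _)
  have h2 := hz.decay
  have h3 := hz.nonneg
  by_contra h
  have := mul_neg_of_neg_of_pos (not_le.1 h) (sub_pos.2 hz.lt)
  linarith

/-- White noise is isotropic. -/
theorem IsBoundedWhiteNoise.integral_inner_sq {Ω : Type*} [MeasurableSpace Ω] {P : Measure Ω}
    [IsProbabilityMeasure P] {d : ℕ} {r : Ω → EuclideanSpace ℝ (Fin d)} {ρ s : ℝ}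
    (hr : IsBoundedWhiteNoise P r ρ s) (v : EuclideanSpace ℝ (Fin d)) :
    ∫ ω, inner ℝ v (r ω) ^ 2 ∂P = s ^ 2 * ‖v‖ ^ 2 := by
  have hform : ∀ ω, inner ℝ v (r ω) ^ 2 = ∑ a, ∑ b, (v a * v b) * (r ω a * r ω b) := by
    intro ω
    have : inner ℝ v (r ω) = ∑ a, v a * r ω a := by
      simp [PiLp.inner_apply, mul_comm]
    rw [this, sq, Finset.sum_mul_sum]
    exact Finset.sum_congr rfl fun _ _ => Finset.sum_congr rfl fun _ _ => by ring
  have hmeas : ∀ a, AEMeasurable (fun ω => r ω a) P := fun a =>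
    (Continuous.measurable (by fun_prop : Continuous fun w : EuclideanSpace ℝ (Fin d) => w a)
      ).comp_aemeasurable hr.aemeasurable
  have hint : ∀ a b, Integrable (fun ω => (v a * v b) * (r ω a * r ω b)) P := by
    intro a b
    refine Integrable.const_mul ?_ _
    refine Integrable.of_bound ((hmeas a).mul (hmeas b)).aestronglyMeasurable (ρ * ρ) ?_
    filter_upwards [hr.bounded] with ω hω
    have h0 := norm_nonneg (r ω)
    rw [norm_mul]
    exact mul_le_mul ((PiLp.norm_apply_le _ a).trans hω) ((PiLp.norm_apply_le _ b).trans hω)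
      (norm_nonneg _) (h0.trans hω)
  have hcov : ∀ a b, ∫ ω, r ω a * r ω b ∂P = if a = b then s ^ 2 else 0 := by
    intro a b
    have := congrFun (congrFun hr.covariance a) b
    simpa [Matrix.one_apply] using this
  simp only [hform]
  rw [integral_finsetSum _ fun a _ => integrable_finsetSum _ fun b _ => hint a b]
  have : ∀ a, ∫ ω, ∑ b, (v a * v b) * (r ω a * r ω b) ∂P = s ^ 2 * v a ^ 2 := by
    intro a
    rw [integral_finsetSum _ fun b _ => hint a b]
    simp only [integral_const_mul, hcov, mul_ite, mul_zero, Finset.sum_ite_eq, Finset.mem_univ,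
      if_true]
    ring
  simp only [this, ← Finset.mul_sum, EuclideanSpace.norm_sq_eq, Real.norm_eq_abs, sq_abs]

end DictLearn

/-! ### Assembly of the theorem -/

theorem mainTheorem7 {d K : ℕ} (hK : 2 ≤ K)
    (Φ : DictLearn.Dict d K) (A μ : ℝ) (hA : A = (K : ℝ) / (d : ℝ))
    (hΦ : Φ ∈ DictLearn.admissible d K) (hΦA : DictLearn.IsTightFrame Φ A)
    (hμ : μ = DictLearn.coherence Φ)
    (ν : Measure (DictLearn.Sph K)) [IsProbabilityMeasure ν] (hν : DictLearn.IsSymmetric ν)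
    (cbar : ℝ)
    (hcbar : cbar ^ 2 = ∫ x : DictLearn.Sph K,
      ‖WithLp.ofLp (x : EuclideanSpace ℝ (Fin K))‖ ^ 2 ∂ν)
    {Ω : Type*} [MeasurableSpace Ω] (P : Measure Ω) [IsProbabilityMeasure P]
    (x : Ω → DictLearn.Sph K) (hx : HasLaw x ν P)
    (r : Ω → EuclideanSpace ℝ (Fin d)) (ρ s : ℝ)
    (hr : DictLearn.IsBoundedWhiteNoise P r ρ s) (hxr : IndepFun x r P)
    (y : Ω → EuclideanSpace ℝ (Fin d))
    (hy : ∀ ω, y ω = DictLearn.synth Φ (x ω : EuclideanSpace ℝ (Fin K)) + r ω)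
    (β : ℝ) (hβ : β < 1 / 2)
    (hdecay : ∀ᵐ z : DictLearn.Sph K ∂ν,
      DictLearn.rearr (z : EuclideanSpace ℝ (Fin K)) ⟨1, by omega⟩
          < DictLearn.rearr (z : EuclideanSpace ℝ (Fin K)) ⟨0, by omega⟩ ∧
      (DictLearn.rearr (z : EuclideanSpace ℝ (Fin K)) ⟨1, by omega⟩
          + μ * ∑ k, |DictLearn.rearr (z : EuclideanSpace ℝ (Fin K)) k| + ρ)
        / (DictLearn.rearr (z : EuclideanSpace ℝ (Fin K)) ⟨0, by omega⟩
          - DictLearn.rearr (z : EuclideanSpace ℝ (Fin K)) ⟨1, by omega⟩) ≤ β) :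
    IsLocalMaxOn (DictLearn.objective P y) (DictLearn.admissible d K) Φ ∧
    (∀ Ψ : DictLearn.Dict d K, Integrable (fun ω => ‖DictLearn.analysis Ψ (y ω)‖ ^ 2) P) ∧
    ∀ ε : ℝ, ε < 1 / 5 →
      ε ≤ (1 - 2 * β) ^ 2 /
        (2 * A * Real.log (2 * A * K / (cbar ^ 2 - (1 - cbar ^ 2) / ((K : ℝ) - 1)))) →
      ∀ Ψ ∈ DictLearn.admissible d K,
        0 < DictLearn.dictDist Ψ Φ → DictLearn.dictDist Ψ Φ ≤ ε →
        DictLearn.objective P y Ψ < DictLearn.objective P y Φ := by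
  have hx' : AEMeasurable x P := hx.aemeasurable
  have hr' := hr.aemeasurable
  have hne : Nonempty (Fin K) := ⟨⟨0, by omega⟩⟩
  have hKr : (2 : ℝ) ≤ K := by exact_mod_cast hK
  set τ := P.map r with hτdef
  have hτp : IsProbabilityMeasure τ := Measure.isProbabilityMeasure_map hr'
  -- Independence turns the joint law into a product, so all expectations become integrals against
  -- `ν.prod τ`.
  have hlaw : P.map (fun ω => (x ω, r ω)) = ν.prod τ := by
    rw [(indepFun_iff_map_prod_eq_prod_map_map hx' hr').1 hxr, hx.map_eq]
  have hτ : ∀ᵐ w ∂τ, ‖w‖ ≤ ρ :=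
    (ae_map_iff hr' (measurableSet_le measurable_norm measurable_const)).2 hr.bounded
  have hcov : ∀ v : EuclideanSpace ℝ (Fin d), ∫ w, inner ℝ v w ^ 2 ∂τ = s ^ 2 * ‖v‖ ^ 2 := by
    intro v
    rw [hτdef, integral_map hr' (Continuous.aestronglyMeasurable (by fun_prop)),
      hr.integral_inner_sq]
  have hobs : ∀ Ψ : DictLearn.Dict d K, (fun ω => ‖DictLearn.analysis Ψ (y ω)‖ ^ 2)
      = DictLearn.response Φ Ψ ∘ fun ω => (x ω, r ω) := by
    intro Ψ
    funext ω
    simp only [hy, Function.comp, DictLearn.response]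
  have hobj : ∀ Ψ, DictLearn.objective P y Ψ = ∫ q, DictLearn.response Φ Ψ q ∂ν.prod τ := by
    intro Ψ
    rw [DictLearn.objective, hobs, ← hlaw, integral_map (hx'.prodMk hr')
      (DictLearn.continuous_response Φ Ψ).aestronglyMeasurable]
    rfl
  have hint : ∀ Ψ : DictLearn.Dict d K,
      Integrable (fun ω => ‖DictLearn.analysis Ψ (y ω)‖ ^ 2) P := by
    intro Ψ
    rw [hobs, ← integrable_map_measure
      (DictLearn.continuous_response Φ Ψ).aestronglyMeasurable (hx'.prodMk hr'), hlaw]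
    exact DictLearn.integrable_response Φ Ψ hΦA hτ
  have hρ0 : 0 ≤ ρ := by
    obtain ⟨w, hw⟩ := hτ.exists
    exact (norm_nonneg w).trans hw
  have hμ0 : 0 ≤ μ := hμ ▸ DictLearn.coherence_nonneg Φ
  have hμ' : ∀ j k, j ≠ k → |inner ℝ (Φ j) (Φ k)| ≤ μ :=
    hμ ▸ DictLearn.abs_inner_le_coherence Φ
  have hdec : ∀ᵐ z : DictLearn.Sph K ∂ν, ∃ i c,
      DictLearn.DecayAt μ ρ β (z : EuclideanSpace ℝ (Fin K)) i c :=
    hdecay.mono fun z hz => DictLearn.exists_decayAt (by omega) (by omega) hz.1 hz.2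
  have hdom : ∀ᵐ z ∂ν, ∃ i, z ∈ DictLearn.dominant i :=
    hdec.mono fun z ⟨i, _, hz⟩ => ⟨i, hz.mem_dominant⟩
  have hβ0 : 0 ≤ β := by
    obtain ⟨z, i, c, hz⟩ := hdec.exists
    exact hz.beta_nonneg hμ0 hρ0
  have hA1 : 1 ≤ A := hΦA.one_le hΦ ⟨0, by omega⟩
  obtain ⟨hg0, hm1⟩ := DictLearn.moment_gap_pos hK hdom hcbar
  have hg1 : cbar ^ 2 - (1 - cbar ^ 2) / ((K : ℝ) - 1) ≤ 1 := by
    have : 0 ≤ (1 - cbar ^ 2) / ((K : ℝ) - 1) := div_nonneg (by linarith) (by linarith)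
    linarith
  have hL := DictLearn.log_ratio_ge hA1 hKr hg0 hg1
  have hstrict : ∀ ε : ℝ, ε < 1 / 5 →
      ε ≤ (1 - 2 * β) ^ 2 /
        (2 * A * Real.log (2 * A * K / (cbar ^ 2 - (1 - cbar ^ 2) / ((K : ℝ) - 1)))) →
      ∀ Ψ ∈ DictLearn.admissible d K,
        0 < DictLearn.dictDist Ψ Φ → DictLearn.dictDist Ψ Φ ≤ ε →
        DictLearn.objective P y Ψ < DictLearn.objective P y Φ := by
    intro ε hε5 hε Ψ hΨ hpos hle
    set e := DictLearn.dictDist Ψ Φ with he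
    have he5 : e < 1 / 5 := hle.trans_lt hε5
    have heε := hle.trans hε
    -- The factor `A * L` in the denominator is at least `1.38`, so dropping it only weakens the
    -- bound.
    have heβ : e ≤ (1 - 2 * β) ^ 2 / 2 :=
      heε.trans (div_le_div_of_nonneg_left (sq_nonneg _) two_pos (by nlinarith))
    have hd := DictLearn.norm_sub_le_dictDist Ψ Φ
    rw [hobj, hobj]
    have h1 := DictLearn.integral_response_le (ν := ν) hν hμ0 hΦA hA1 hΦ hΨ hμ' hd hβ0 hβ hpos he5
      heβ hτ hcov hdec
    have h2 := DictLearn.le_integral_response (ν := ν) hν Φ Φ hΦ hΦA hτ hcov hdec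
    have h3 := DictLearn.integral_dominantResponse_sub (ν := ν) hK hν hcbar hΦA hΦ hΨ hτ hcov hdom
    have h4 := DictLearn.excess_lt hA1 hK hg0 hg1 hpos he5 heε
    -- All summands are nonnegative because the distances are below one; the atom realising the
    -- maximum distance alone gives the left side.
    have h5 : e ^ 2 - e ^ 4 / 4 ≤ ∑ i, (‖Ψ i - Φ i‖ ^ 2 - ‖Ψ i - Φ i‖ ^ 4 / 4) := by
      obtain ⟨i, hi⟩ := DictLearn.exists_norm_sub_eq_dictDist Ψ Φ
      rw [← he] at hi
      rw [← hi]
      refine Finset.single_le_sum (f := fun i => ‖Ψ i - Φ i‖ ^ 2 - ‖Ψ i - Φ i‖ ^ 4 / 4)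
        (fun j _ => ?_) (Finset.mem_univ i)
      have h6 : ‖Ψ j - Φ j‖ ^ 2 ≤ 1 := by
        have := hd j
        have := norm_nonneg (Ψ j - Φ j)
        nlinarith
      nlinarith [sq_nonneg (‖Ψ j - Φ j‖)]
    have h6 := mul_le_mul_of_nonneg_left h5 (div_nonneg hg0.le (by linarith : (0 : ℝ) ≤ K))
    linarith
  refine ⟨?_, hint, hstrict⟩
  -- Any number below `1 / 5` would serve in place of `1 / 6`, since the strict result needs `ε < 1
  -- / 5`.
  set ε₀ := min (1 / 6) ((1 - 2 * β) ^ 2 /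
    (2 * A * Real.log (2 * A * K / (cbar ^ 2 - (1 - cbar ^ 2) / ((K : ℝ) - 1))))) with hε₀
  have hε₀pos : 0 < ε₀ := by
    refine lt_min (by norm_num) (div_pos (pow_pos (by linarith) 2) ?_)
    exact mul_pos (by linarith) (by linarith)
  refine Filter.mem_of_superset (inter_mem_nhdsWithin _ (Metric.ball_mem_nhds Φ hε₀pos)) ?_
  rintro Ψ ⟨hΨ, hball⟩
  rcases (DictLearn.dictDist_nonneg Ψ Φ).eq_or_lt with h0 | h0
  · have hΨΦ : Ψ = Φ := by
      funext i
      have := DictLearn.norm_sub_le_dictDist Ψ Φ i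
      rw [← h0] at this
      exact sub_eq_zero.1 (norm_le_zero_iff.1 this)
    rw [hΨΦ]
    exact le_refl (DictLearn.objective P y Φ)
  · exact (hstrict ε₀ ((min_le_left _ _).trans_lt (by norm_num)) (min_le_right _ _) Ψ hΨ h0
      ((DictLearn.dictDist_le_dist Ψ Φ).trans (Metric.mem_ball.1 hball).le)).le
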